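/- Let $X$ be a complex Banach space and let $S$ be a linear operator from a (not necessarily dense) subspace $\mathcal D(S)\subset X$ into $X$, with resolvent set $\varrho(S)$ (all $\lambda$ for which $S-\lambda:\mathcal D(S)\to X$ is bijective with bounded inverse) and spectrum $\sigma(S)=\mathbb C\setminus\varrho(S)$. Let $\mathbb C_\pm=\{\pm\operatorname{Re}\lambda>0\}$, $\Sigma_\theta=\{z\in\mathbb C:|\arg z|\le\theta\}$ with $\arg 0=0$, and $\Omega_\theta=\{\lambda:\theta<|\arg\lambda|<\pi-\theta\}$. $S$ is called bisectorial if $i\mathbb R\setminus\{0\}\subset\varrho(S)$ and $\|(S-\lambda)^{-1}\|\le M/|\lambda|$ for $\lambda\in i\mathbb R\setminus\{0\}$ with some $M>0$, and almost bisectorial with constants $M>0$ and $0<\beta<1$ if $i\mathbb R\setminus\{0\}\subset\varrho(S)$ and $\|(S-\lambda)^{-1}\|\le M/|\lambda|^{\beta}$ for $\lambda\in i\mathbb R\setminus\{0\}$. An operator $T$ is called sectorial with angle $0<\theta<\pi$ and constant $M>0$ (respectively almost sectorial with angle $0<\theta<\pi$ and constants $M>0$, $0<\beta<1$) if $\sigma(T)\subset\Sigma_\theta$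 and $\|(T-\lambda)^{-1}\|\le M/|\lambda|$ (respectively $\|(T-\lambda)^{-1}\|\le M/|\lambda|^\beta$) for all $\lambda\in\mathbb C\setminus\Sigma_\theta$. Let $G_\pm$ be the set of all $x\in X$ for which $\lambda\mapsto(S-\lambda)^{-1}x$, $\lambda\in\varrho(S)$, has an analytic extension to $\overline{\mathbb C_\mp}\cup\varrho(S)$ that is bounded on $\overline{\mathbb C_\mp}$. Call $h>0$ admissible if $\{|\operatorname{Re}\lambda|\le h\}\subset\varrho(S)$ and $\sup_{|\operatorname{Re}\lambda|\le h}\|(S-\lambda)^{-1}\|<\infty$. For admissible $h$ put $$A_\pm=\frac{\pm1}{2\pi i}\int_{\pm h-i\infty}^{\pm h+i\infty}\frac1{\lambda^2}(S-\lambda)^{-1}\,d\lambda,\qquad B_\pm=\frac{\pm1}{2\pi i}\int_{\pm h-i\infty}^{\pm h+i\infty}\frac1{\lambda}(S-\lambda)^{-1}\,d\lambda,\qquad P_\pm=S^2A_\pm,$$ where products of operators carry their natural domains. 1. Let $S$ be almost bisectorial with constants $M,\beta$. Then admissible $h>0$ exist. For all admissible $h$ and $h'$, with $P_\pm$ formed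 with $h$ and $B_\pm$ with $h'$, the integrals defining $A_\pm$ and $B_\pm$ converge absolutely in operator norm, $P_\pm=SB_\pm$ (equality of operators, domains included), $\mathcal D(S)\subset\mathcal D(P_\pm)$, and $$P_\pm x=\frac{\pm1}{2\pi i}\int_{\pm h'-i\infty}^{\pm h'+i\infty}\frac1\lambda(S-\lambda)^{-1}Sx\,d\lambda,\qquad x\in\mathcal D(S),$$ with absolutely convergent integrals. 2. Let $S$ be almost bisectorial with constants $M,\beta$. Then $G_\pm$ are closed $S$-invariant subspaces, and the operators $\pm S|G_\pm$ in $G_\pm$ (with domain $\mathcal D(S)\cap G_\pm$) are almost sectorial with angle $\pi/2$ and the same constants $M,\beta$. 3. Let $S$ be bisectorial with $0\in\varrho(S)$. Then there are $0<\theta<\pi/2$ and $M>0$ such that $\Omega_\theta\subset\varrho(S)$ and $\|(S-\lambda)^{-1}\|\le M/|\lambda|$ on $\Omega_\theta$; and for all such $\theta$ and $M$ the subspaces $G_\pm$ are closed and $S$-invariant, and $\pm S|G_\pm$ are sectorial with angle $\theta$ and the same constant $M$. -/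

import Mathlib

open MeasureTheory

noncomputable section

namespace SpectralSplitting

section Operators

variable {X : Type*} [NormedAddCommGroup X] [NormedSpace ℂ X]

/-- The bounded operator `R` is a two-sided inverse of `S - l`. -/
def IsResolventAt (S : X →ₗ.[ℂ] X) (l : ℂ) (R : X →L[ℂ] X) : Prop :=
  (∀ y : X, ∃ hy : R y ∈ S.domain, S ⟨R y, hy⟩ - l • R y = y) ∧
    ∀ x : S.domain, R (S x - l • (x : X)) = x

/-- The set of all `l` for which `S - l` is a bijection from the domain onto `X` with bounded
inverse. -/
def resolventSet (S : X →ₗ.[ℂ] X) : Set ℂ :=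
  {l | ∃ R : X →L[ℂ] X, IsResolventAt S l R}

def spectrum (S : X →ₗ.[ℂ] X) : Set ℂ := (resolventSet S)ᶜ

open Classical in
/-- `(S - l)⁻¹` for `l` in the resolvent set (and `0` elsewhere, where it is never used). -/
def resolvent (S : X →ₗ.[ℂ] X) (l : ℂ) : X →L[ℂ] X :=
  if h : l ∈ resolventSet S then h.choose else 0

/-- The product `T S` of two operators, with its natural domain `{x ∈ D(S) : S x ∈ D(T)}`. -/
def prodOp (T S : X →ₗ.[ℂ] X) : X →ₗ.[ℂ] X where
  domain :=
    { carrier := {x | ∃ hx : x ∈ S.domain, S ⟨x, hx⟩ ∈ T.domain}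
      add_mem' := by
        rintro a b ⟨ha, ha'⟩ ⟨hb, hb'⟩
        refine ⟨S.domain.add_mem ha hb, ?_⟩
        have h := S.map_add ⟨a, ha⟩ ⟨b, hb⟩
        exact h ▸ T.domain.add_mem ha' hb'
      zero_mem' := ⟨S.domain.zero_mem, by
        have h : S ⟨0, S.domain.zero_mem⟩ = 0 := S.map_zero
        rw [h]
        exact T.domain.zero_mem⟩
      smul_mem' := by
        rintro c a ⟨ha, ha'⟩
        refine ⟨S.domain.smul_mem c ha, ?_⟩
        have h := S.map_smul c ⟨a, ha⟩
        exact h ▸ T.domain.smul_mem c ha' }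
  toFun :=
    { toFun := fun x => T ⟨S ⟨x, x.2.fst⟩, x.2.snd⟩
      map_add' := by
        intro x y
        rw [← T.map_add]
        congr 1
        apply Subtype.ext
        exact S.map_add ⟨x, x.2.fst⟩ ⟨y, y.2.fst⟩
      map_smul' := by
        intro c x
        rw [RingHom.id_apply, ← T.map_smul]
        congr 1
        apply Subtype.ext
        exact S.map_smul c ⟨x, x.2.fst⟩ }

/-- A bounded operator on `X`, seen as an operator with domain `X`. -/
def ofBounded (A : X →L[ℂ] X) : X →ₗ.[ℂ] X := (A : X →ₗ[ℂ] X).toPMap ⊤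

/-- The subspace `G` is `S`-invariant: `S` maps `D(S) ∩ G` into `G`. -/
def IsInvariant (S : X →ₗ.[ℂ] X) (G : Submodule ℂ X) : Prop :=
  ∀ x : S.domain, (x : X) ∈ G → S x ∈ G

/-- The restriction `S|G` to an `S`-invariant subspace `G`, as an operator in `G` with domain
`D(S) ∩ G`. -/
def restrictOp (S : X →ₗ.[ℂ] X) (G : Submodule ℂ X) (hG : IsInvariant S G) : G →ₗ.[ℂ] G where
  domain := S.domain.comap G.subtype
  toFun :=
    { toFun := fun x => ⟨S ⟨(x : G), x.2⟩, hG ⟨(x : G), x.2⟩ (x : G).2⟩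
      map_add' := fun x y => Subtype.ext (S.map_add ⟨(x : G), x.2⟩ ⟨(y : G), y.2⟩)
      map_smul' := fun c x => Subtype.ext (S.map_smul c ⟨(x : G), x.2⟩) }

end Operators

section Sectors

/-- The closed sector `{z : |arg z| ≤ θ}`; it contains `0`. -/
def sector (θ : ℝ) : Set ℂ := {z | |z.arg| ≤ θ}

/-- The open bisector around the imaginary axis. -/
def bisector (θ : ℝ) : Set ℂ := {z | θ < |z.arg| ∧ |z.arg| < Real.pi - θ}

variable {X : Type*} [NormedAddCommGroup X] [NormedSpace ℂ X]

/-- `S` is sectorial with angle `θ` and constant `M`. -/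
def IsSectorialWith (S : X →ₗ.[ℂ] X) (θ M : ℝ) : Prop :=
  0 < θ ∧ θ < Real.pi ∧ 0 < M ∧ spectrum S ⊆ sector θ ∧
    ∀ l : ℂ, l ∉ sector θ → ‖resolvent S l‖ ≤ M / ‖l‖

/-- `S` is almost sectorial with angle `θ` and constants `M`, `β`. -/
def IsAlmostSectorialWith (S : X →ₗ.[ℂ] X) (θ M β : ℝ) : Prop :=
  0 < β ∧ β < 1 ∧ 0 < θ ∧ θ < Real.pi ∧ 0 < M ∧ spectrum S ⊆ sector θ ∧
    ∀ l : ℂ, l ∉ sector θ → ‖resolvent S l‖ ≤ M / ‖l‖ ^ β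

/-- `S` is bisectorial: `iℝ \ {0}` lies in the resolvent set and `‖(S - l)⁻¹‖ ≤ M / |l|` there. -/
def IsBisectorial (S : X →ₗ.[ℂ] X) : Prop :=
  ∃ M : ℝ, 0 < M ∧ ∀ l : ℂ, l.re = 0 → l ≠ 0 →
    l ∈ resolventSet S ∧ ‖resolvent S l‖ ≤ M / ‖l‖

/-- The bisector with angle `0 < θ < π/2` lies in the resolvent set, and the bisectorial estimate
holds on it with constant `M`. -/
def IsBisectorialOn (S : X →ₗ.[ℂ] X) (θ M : ℝ) : Prop :=
  0 < θ ∧ θ < Real.pi / 2 ∧ 0 < M ∧ ∀ l ∈ bisector θ,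
    l ∈ resolventSet S ∧ ‖resolvent S l‖ ≤ M / ‖l‖

/-- `S` is almost bisectorial with constants `M` and `β`. -/
def IsAlmostBisectorialWith (S : X →ₗ.[ℂ] X) (M β : ℝ) : Prop :=
  0 < β ∧ β < 1 ∧ 0 < M ∧ ∀ l : ℂ, l.re = 0 → l ≠ 0 →
    l ∈ resolventSet S ∧ ‖resolvent S l‖ ≤ M / ‖l‖ ^ β

end Sectors

section Splitting

variable {X : Type*} [NormedAddCommGroup X] [NormedSpace ℂ X]

/-- `φ` is a bounded analytic extension of `l ↦ (S - l)⁻¹ x` to the set `H`: it is analytic on a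
neighbourhood of `H ∪ ϱ(S)`, bounded on `H`, and equal to `(S - l)⁻¹ x` on `ϱ(S)`. -/
def IsBoundedExtension (S : X →ₗ.[ℂ] X) (H : Set ℂ) (x : X) (φ : ℂ → X) : Prop :=
  AnalyticOnNhd ℂ φ (H ∪ resolventSet S) ∧ (∃ K : ℝ, ∀ l ∈ H, ‖φ l‖ ≤ K) ∧
    ∀ l ∈ resolventSet S, φ l = resolvent S l x

/-- The subspaces `G₊` (for `s = 1`) and `G₋` (for `s = -1`): all `x` such that `(S - l)⁻¹ x` has a
bounded analytic extension to the closed left, respectively right, half-plane. -/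
def splitSpace (S : X →ₗ.[ℂ] X) (s : ℤˣ) : Submodule ℂ X where
  carrier := {x | ∃ φ : ℂ → X, IsBoundedExtension S {l | ((s : ℤ) : ℝ) * l.re ≤ 0} x φ}
  add_mem' := by
    rintro x y ⟨φ, h1, ⟨K, h2⟩, h3⟩ ⟨ψ, g1, ⟨L, g2⟩, g3⟩
    refine ⟨φ + ψ, h1.add g1, ⟨K + L, fun l hl => ?_⟩, fun l hl => ?_⟩
    · exact (norm_add_le _ _).trans (add_le_add (h2 l hl) (g2 l hl))
    · rw [Pi.add_apply, h3 l hl, g3 l hl, map_add]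
  zero_mem' := ⟨fun _ => 0, analyticOnNhd_const, ⟨0, fun _ _ => by simp⟩, fun _ _ => by simp⟩
  smul_mem' := by
    rintro c x ⟨φ, h1, ⟨K, h2⟩, h3⟩
    refine ⟨fun l => c • φ l, fun l hl => (h1 l hl).const_smul, ⟨‖c‖ * K, fun l hl => ?_⟩,
      fun l hl => ?_⟩
    · rw [norm_smul]
      exact mul_le_mul_of_nonneg_left (h2 l hl) (norm_nonneg c)
    · simp only [h3 l hl, map_smul]

/-- The closed strip of half-width `h > 0` around the imaginary axis lies in the resolvent set, and
the resolvent is bounded on it. -/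
def StripBounded (S : X →ₗ.[ℂ] X) (h : ℝ) : Prop :=
  0 < h ∧ (∀ l : ℂ, |l.re| ≤ h → l ∈ resolventSet S) ∧
    ∃ C : ℝ, ∀ l : ℂ, |l.re| ≤ h → ‖resolvent S l‖ ≤ C

section Lines

variable {E : Type*} [NormedAddCommGroup E] [NormedSpace ℂ E]

/-- Absolute integrability of `f` along the line `Re l = a`. -/
def LineIntegrable (f : ℂ → E) (a : ℝ) : Prop :=
  Integrable fun t : ℝ => f ((a : ℂ) + (t : ℂ) * Complex.I)

/-- The integral of `f` from `a - i∞` to `a + i∞`. -/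
def lineIntegral (f : ℂ → E) (a : ℝ) : E :=
  ∫ t : ℝ, Complex.I • f ((a : ℂ) + (t : ℂ) * Complex.I)

end Lines

/-- The factor `± 1 / (2 π i)`. -/
def cauchyFactor (s : ℤˣ) : ℂ := ((s : ℤ) : ℂ) / (2 * (Real.pi : ℂ) * Complex.I)

/-- The abscissa `± h`. -/
def abscissa (s : ℤˣ) (h : ℝ) : ℝ := ((s : ℤ) : ℝ) * h

/-- `A₊` and `A₋`: `± 1 / (2 π i)` times the integral of `l⁻² (S - l)⁻¹` over `Re l = ± h`. -/
def opA (S : X →ₗ.[ℂ] X) (s : ℤˣ) (h : ℝ) : X →L[ℂ] X :=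
  cauchyFactor s • lineIntegral (fun l => (1 / l ^ 2) • resolvent S l) (abscissa s h)

/-- `B₊` and `B₋`: `± 1 / (2 π i)` times the integral of `l⁻¹ (S - l)⁻¹` over `Re l = ± h`. -/
def opB (S : X →ₗ.[ℂ] X) (s : ℤˣ) (h : ℝ) : X →L[ℂ] X :=
  cauchyFactor s • lineIntegral (fun l => (1 / l) • resolvent S l) (abscissa s h)

/-- `P₊ = S² A₊` and `P₋ = S² A₋`, with their natural domains. -/
def opP (S : X →ₗ.[ℂ] X) (s : ℤˣ) (h : ℝ) : X →ₗ.[ℂ] X :=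
  prodOp (prodOp S S) (ofBounded (opA S s h))

end Splitting

end SpectralSplitting

end

noncomputable section

namespace SpectralSplitting

open Filter Topology

/-! ### Resolvent calculus and Neumann series. -/

section Resolvent

variable {X : Type*} [NormedAddCommGroup X] [NormedSpace ℂ X] {S : X →ₗ.[ℂ] X} {l m : ℂ}

/-! Neumann series give the uniform picture near the imaginary axis. If β < 1, the disc of
convergence around `it` has radius at least t^β/M, which exceeds t for small t > 0, so 0 is in the
resolvent set. Compactness then bounds the resolvent R(l) by some C on the whole axis, and a further
Neumann series yields a strip.

For the projections, R(0)R(l)/l = (R(l) - R(0))/l² is integrated along the line. The integral of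
1/l² vanishes, so A = S⁻¹B (`resolvent_zero_mul_opB`). Cauchy's theorem makes B independent of h, so
SA = B on all of X and S²A = SB with equal domains. Since B commutes with S⁻¹, it maps the domain of
S into itself, with SBx = BSx.

For the subspaces, an extension φ of R(·)x is unique by the identity theorem started at 0.
Phragmén–Lindelöf carries bounds from the axis to the half-plane with unchanged constants: this
gives ‖φ(l)‖ ≤ C‖x‖, hence closedness of G, and, applied to x + lφ(l), invariance. The equation (S -
l)φ(l) = x continues analytically, and φ(m) is again in G because the difference quotients of φ at m
extend R(·)φ(m) (`IsBoundedExtension.dslope`). So x ↦ φ(m) is the resolvent of S|G at m.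
Phragmén–Lindelöf for a branch of (∓l)^β φ(l) gives the sectorial bounds. -/

theorem isResolventAt_resolvent (hl : l ∈ resolventSet S) :
    IsResolventAt S l (resolvent S l) := by
  rw [resolvent, dif_pos hl]
  exact hl.choose_spec

theorem resolvent_mem_domain (hl : l ∈ resolventSet S) (y : X) :
    resolvent S l y ∈ S.domain :=
  ((isResolventAt_resolvent hl).1 y).fst

theorem apply_resolvent (hl : l ∈ resolventSet S) (y : X) :
    S ⟨resolvent S l y, resolvent_mem_domain hl y⟩ = y + l • resolvent S l y :=
  sub_eq_iff_eq_add.1 ((isResolventAt_resolvent hl).1 y).snd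

theorem resolvent_apply (hl : l ∈ resolventSet S) (x : S.domain) :
    resolvent S l (S x) = x + l • resolvent S l x := by
  have h := (isResolventAt_resolvent hl).2 x
  rwa [map_sub, map_smul, sub_eq_iff_eq_add] at h

/-- An element of the domain is determined by its image under `S - l`. -/
theorem eq_resolvent_of_apply_eq (hl : l ∈ resolventSet S) {x : S.domain} {y : X}
    (h : S x = y + l • (x : X)) : (x : X) = resolvent S l y := by
  have h' := (isResolventAt_resolvent hl).2 x
  rw [h, add_sub_cancel_right] at h'
  exact h'.symm

theorem IsResolventAt.resolvent_eq {R : X →L[ℂ] X} (hR : IsResolventAt S l R) :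
    resolvent S l = R := by
  ext y
  obtain ⟨hy, h⟩ := hR.1 y
  exact (eq_resolvent_of_apply_eq ⟨R, hR⟩ (x := ⟨R y, hy⟩) (sub_eq_iff_eq_add.1 h)).symm

/-- The resolvent identity. -/
theorem resolvent_eq_add (hl : l ∈ resolventSet S) (hm : m ∈ resolventSet S) (y : X) :
    resolvent S l y = resolvent S m y + (l - m) • resolvent S l (resolvent S m y) := by
  have h := resolvent_apply hl ⟨resolvent S m y, resolvent_mem_domain hm y⟩
  rw [apply_resolvent hm, map_add, map_smul] at h
  rw [sub_smul]
  linear_combination (norm := module) h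

theorem resolvent_comm (hl : l ∈ resolventSet S) (hm : m ∈ resolventSet S) (y : X) :
    resolvent S l (resolvent S m y) = resolvent S m (resolvent S l y) := by
  by_cases hlm : l = m
  · rw [hlm]
  have h₁ := resolvent_eq_add hl hm y
  have h₂ := resolvent_eq_add hm hl y
  refine smul_right_injective X (sub_ne_zero.2 hlm) ?_
  simp only [sub_smul] at h₁ h₂ ⊢
  linear_combination (norm := module) -h₁ - h₂

/-- With R(m) factored out on the left, decay of R(m) transfers to R(l) as long as l - m and R(l)
stay bounded. This serves both the Neumann estimate and the passage from the axis to a parallel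
line. -/
theorem norm_resolvent_le_mul (hl : l ∈ resolventSet S) (hm : m ∈ resolventSet S) :
    ‖resolvent S l‖ ≤ ‖resolvent S m‖ * (1 + ‖l - m‖ * ‖resolvent S l‖) := by
  refine ContinuousLinearMap.opNorm_le_bound _ (by positivity) fun y => ?_
  rw [resolvent_eq_add hl hm y, resolvent_comm hl hm]
  calc _ ≤ ‖resolvent S m y‖ + ‖l - m‖ * ‖resolvent S m (resolvent S l y)‖ :=
        (norm_add_le _ _).trans (by rw [norm_smul])
    _ ≤ ‖resolvent S m‖ * ‖y‖ +
        ‖l - m‖ * (‖resolvent S m‖ * (‖resolvent S l‖ * ‖y‖)) := by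
      gcongr
      · exact ContinuousLinearMap.le_opNorm _ _
      · exact (ContinuousLinearMap.le_opNorm _ _).trans
          (by gcongr; exact ContinuousLinearMap.le_opNorm _ _)
    _ = _ := by ring

/-- On the domain, S - l = (1 - (l - m)R(m))(S - m), so inverting the bounded factor inverts S - l.
-/
theorem isResolventAt_mul_inverse (hm : m ∈ resolventSet S)
    (hu : IsUnit (1 - (l - m) • resolvent S m)) :
    IsResolventAt S l (resolvent S m * Ring.inverse (1 - (l - m) • resolvent S m)) := by
  set R := resolvent S m with hR
  set Q := Ring.inverse (1 - (l - m) • R)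
  have h₁ (y : X) : Q y = y + (l - m) • R (Q y) := by
    have := DFunLike.congr_fun (Ring.mul_inverse_cancel _ hu) y
    exact sub_eq_iff_eq_add.1 (by simpa using this)
  have h₂ (y : X) : Q (y - (l - m) • R y) = y := by
    have := DFunLike.congr_fun (Ring.inverse_mul_cancel _ hu) y
    simpa using this
  refine ⟨fun y => ⟨resolvent_mem_domain hm _, ?_⟩, fun x => ?_⟩
  · have := apply_resolvent hm (Q y)
    change S ⟨R (Q y), _⟩ - l • R (Q y) = y
    rw [this]
    have := h₁ y
    simp only [sub_smul] at this
    linear_combination (norm := module) this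
  · have hx : R (S x - m • (x : X)) = x := (isResolventAt_resolvent hm).2 x
    have h := h₂ (S x - m • (x : X))
    rw [hx] at h
    change R (Q _) = x
    rw [show S x - l • (x : X) = S x - m • (x : X) - (l - m) • (x : X) by module, h, hx]

variable [CompleteSpace X]

theorem isUnit_one_sub_smul_resolvent (h : ‖l - m‖ * ‖resolvent S m‖ < 1) :
    IsUnit (1 - (l - m) • resolvent S m) :=
  isUnit_one_sub_of_norm_lt_one (by rwa [norm_smul])

theorem mem_resolventSet_of_norm_lt (hm : m ∈ resolventSet S)
    (h : ‖l - m‖ * ‖resolvent S m‖ < 1) : l ∈ resolventSet S :=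
  ⟨_, isResolventAt_mul_inverse hm (isUnit_one_sub_smul_resolvent h)⟩

theorem norm_resolvent_le_of_norm_le_half (hm : m ∈ resolventSet S) {c : ℝ}
    (hc : ‖resolvent S m‖ ≤ c) (h : ‖l - m‖ * c ≤ 1 / 2) :
    l ∈ resolventSet S ∧ ‖resolvent S l‖ ≤ 2 * c := by
  have h' : ‖l - m‖ * ‖resolvent S m‖ ≤ 1 / 2 := le_trans (by gcongr) h
  have hl : l ∈ resolventSet S := mem_resolventSet_of_norm_lt hm (by linarith)
  refine ⟨hl, ?_⟩
  have := norm_resolvent_le_mul hl hm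
  nlinarith [mul_le_mul_of_nonneg_right h' (norm_nonneg (resolvent S l))]

theorem eventually_norm_sub_mul_lt_one (m : ℂ) (c : ℝ) : ∀ᶠ l in 𝓝 m, ‖l - m‖ * c < 1 := by
  have : ContinuousAt (fun l : ℂ => ‖l - m‖ * c) m := by fun_prop
  exact this.eventually_lt_const (by simp)

theorem isOpen_resolventSet : IsOpen (resolventSet S) :=
  isOpen_iff_mem_nhds.2 fun m hm =>
    (eventually_norm_sub_mul_lt_one m ‖resolvent S m‖).mono fun _ h =>
      mem_resolventSet_of_norm_lt hm h

theorem analyticAt_resolvent (hm : m ∈ resolventSet S) : AnalyticAt ℂ (resolvent S) m := by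
  have h : (fun l => resolvent S m * Ring.inverse (1 - (l - m) • resolvent S m)) =ᶠ[𝓝 m]
      resolvent S :=
    (eventually_norm_sub_mul_lt_one m ‖resolvent S m‖).mono fun l h =>
      (isResolventAt_mul_inverse hm (isUnit_one_sub_smul_resolvent h)).resolvent_eq.symm
  refine AnalyticAt.congr (analyticAt_const.mul ?_) h
  refine AnalyticAt.fun_comp (g := Ring.inverse) ?_ (by fun_prop)
  simpa using analyticAt_inverse (𝕜 := ℂ) (1 : (X →L[ℂ] X)ˣ)

theorem analyticAt_resolvent_apply (hm : m ∈ resolventSet S) (x : X) :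
    AnalyticAt ℂ (fun l => resolvent S l x) m :=
  ((ContinuousLinearMap.apply ℂ X x).analyticAt _).fun_comp (analyticAt_resolvent hm)

/-- If the resolvent set contains the imaginary axis and the resolvent is bounded there away from
`0`, then it is bounded on the whole imaginary axis. -/
theorem exists_norm_resolvent_le_of_re_eq_zero {M : ℝ} (h0 : (0 : ℂ) ∈ resolventSet S)
    (h : ∀ l : ℂ, l.re = 0 → l ≠ 0 → l ∈ resolventSet S)
    (hM : ∀ l : ℂ, l.re = 0 → 1 ≤ ‖l‖ → ‖resolvent S l‖ ≤ M) :
    ∃ C : ℝ, 0 < C ∧ ∀ l : ℂ, l.re = 0 → l ∈ resolventSet S ∧ ‖resolvent S l‖ ≤ C := by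
  have hmem : ∀ l : ℂ, l.re = 0 → l ∈ resolventSet S := fun l hl => by
    by_cases hl0 : l = 0
    · exact hl0 ▸ h0
    · exact h l hl hl0
  have hK : IsCompact (Metric.closedBall (0 : ℂ) 1 ∩ {l | l.re = 0}) :=
    (isCompact_closedBall _ _).inter_right (isClosed_eq Complex.continuous_re continuous_const)
  obtain ⟨C, hC⟩ := hK.exists_bound_of_continuousOn (f := resolvent S) fun l hl =>
    (analyticAt_resolvent (hmem l hl.2)).continuousAt.continuousWithinAt
  refine ⟨max 1 (max C M), by positivity, fun l hl => ⟨hmem l hl, ?_⟩⟩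
  rcases le_total ‖l‖ 1 with h1 | h1
  · exact (hC l ⟨by simpa using h1, hl⟩).trans (by simp)
  · exact (hM l hl h1).trans (by simp)

/-- At `it` the Neumann condition for reaching 0 is t · M/t^β < 1, which holds for small t > 0
because β < 1. -/
theorem IsAlmostBisectorialWith.zero_mem_resolventSet {M β : ℝ}
    (h : IsAlmostBisectorialWith S M β) : (0 : ℂ) ∈ resolventSet S := by
  obtain ⟨hβ0, hβ1, hM, h⟩ := h
  have ht : Tendsto (fun t : ℝ => t ^ (1 - β) * M) (𝓝[>] 0) (𝓝 0) := by
    have : ContinuousAt (fun t : ℝ => t ^ (1 - β) * M) 0 :=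
      (Real.continuousAt_rpow_const _ _ (Or.inr (by linarith))).mul continuousAt_const
    simpa [ContinuousAt, Real.zero_rpow (sub_pos.2 hβ1).ne'] using
      this.tendsto.mono_left nhdsWithin_le_nhds
  obtain ⟨t, ht1, ht0⟩ := ((ht.eventually_lt_const one_pos).and self_mem_nhdsWithin).exists
  have ht0 : 0 < t := ht0
  obtain ⟨h₁, h₂⟩ := h (t * Complex.I) (by simp) (by simp [ht0.ne'])
  refine mem_resolventSet_of_norm_lt h₁ ?_
  have hn : ‖(t : ℂ) * Complex.I‖ = t := by simp [abs_of_pos ht0]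
  rw [zero_sub, norm_neg]
  rw [hn] at h₂ ⊢
  calc t * _ ≤ t * (M / t ^ β) := by gcongr
    _ = t ^ (1 - β) * M := by rw [Real.rpow_sub ht0, Real.rpow_one]; ring
    _ < 1 := ht1

theorem IsAlmostBisectorialWith.exists_bound {M β : ℝ} (h : IsAlmostBisectorialWith S M β) :
    ∃ C : ℝ, 0 < C ∧ ∀ l : ℂ, l.re = 0 → l ∈ resolventSet S ∧ ‖resolvent S l‖ ≤ C := by
  refine exists_norm_resolvent_le_of_re_eq_zero (M := M) h.zero_mem_resolventSet
    (fun l hl hl0 => (h.2.2.2 l hl hl0).1) fun l hl hl1 => ?_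
  have hl0 : l ≠ 0 := norm_pos_iff.1 (by linarith)
  exact (h.2.2.2 l hl hl0).2.trans
    (div_le_self h.2.2.1.le (Real.one_le_rpow hl1 h.1.le))

theorem IsBisectorial.exists_bound (h : IsBisectorial S) (h0 : (0 : ℂ) ∈ resolventSet S) :
    ∃ C : ℝ, 0 < C ∧ ∀ l : ℂ, l.re = 0 → l ∈ resolventSet S ∧ ‖resolvent S l‖ ≤ C := by
  obtain ⟨M, hM, h⟩ := h
  refine exists_norm_resolvent_le_of_re_eq_zero (M := M) h0
    (fun l hl hl0 => (h l hl hl0).1) fun l hl hl1 => ?_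
  have hl0 : l ≠ 0 := norm_pos_iff.1 (by linarith)
  exact (h l hl hl0).2.trans (div_le_self hM.le hl1)

theorem exists_stripBounded {C : ℝ} (hC0 : 0 < C)
    (hC : ∀ l : ℂ, l.re = 0 → l ∈ resolventSet S ∧ ‖resolvent S l‖ ≤ C) :
    ∃ h : ℝ, StripBounded S h := by
  have key : ∀ l : ℂ, |l.re| ≤ 1 / (2 * C) → l ∈ resolventSet S ∧ ‖resolvent S l‖ ≤ 2 * C := by
    intro l hl
    obtain ⟨h₁, h₂⟩ := hC (l.im * Complex.I) (by simp)
    refine norm_resolvent_le_of_norm_le_half h₁ h₂ ?_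
    have : l - l.im * Complex.I = l.re := by
      rw [sub_eq_iff_eq_add, Complex.re_add_im]
    rw [this, Complex.norm_real, Real.norm_eq_abs]
    calc _ ≤ 1 / (2 * C) * C := by gcongr
      _ = 1 / 2 := by field_simp
  exact ⟨1 / (2 * C), by positivity, fun l hl => (key l hl).1, 2 * C, fun l hl => (key l hl).2⟩

end Resolvent

/-! ### Phragmén–Lindelöf on half-planes. -/

section HalfPlane

variable {E : Type*} [NormedAddCommGroup E] [NormedSpace ℂ E]

/-- Phragmén–Lindelöf in the right half-plane for functions of at most linear growth. -/
theorem norm_le_of_re_nonneg_of_linear_growth {f : ℂ → E} {C K : ℝ}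
    (hd : DiffContOnCl ℂ f {z | 0 < z.re})
    (hg : ∀ z : ℂ, 0 ≤ z.re → ‖f z‖ ≤ K * (1 + ‖z‖))
    (him : ∀ t : ℝ, ‖f (t * Complex.I)‖ ≤ C) {z : ℂ} (hz : 0 ≤ z.re) : ‖f z‖ ≤ C := by
  have hC : 0 ≤ C := (norm_nonneg _).trans (him 0)
  have hK : 0 ≤ K := by simpa using (norm_nonneg _).trans (hg 0 (by simp))
  have hone : ∀ ε : ℝ, 0 < ε → ∀ w : ℂ, 0 ≤ w.re →
      1 ≤ ‖1 + (ε : ℂ) * w‖ ∧ ε * ‖w‖ ≤ ‖1 + (ε : ℂ) * w‖ := by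
    intro ε hε w hw
    have h1 : 0 ≤ ε * w.re := by positivity
    have hsq : ‖1 + (ε : ℂ) * w‖ ^ 2 = (1 + ε * w.re) ^ 2 + (ε * w.im) ^ 2 := by
      rw [← Complex.normSq_eq_norm_sq, Complex.normSq_apply]
      simp
      ring
    have hsq' : (ε * ‖w‖) ^ 2 = (ε * w.re) ^ 2 + (ε * w.im) ^ 2 := by
      rw [mul_pow, ← Complex.normSq_eq_norm_sq, Complex.normSq_apply]
      ring
    constructor
    · refine (sq_le_sq₀ zero_le_one (norm_nonneg _)).1 ?_
      rw [hsq]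
      nlinarith [sq_nonneg (ε * w.im)]
    · refine (sq_le_sq₀ (by positivity) (norm_nonneg _)).1 ?_
      rw [hsq, hsq']
      nlinarith
  -- Dividing by 1 + εz turns linear growth into boundedness and cannot increase norms, since |1 +
  -- εz| ≥ 1 on the half-plane; ε → 0 removes the factor at the end.
  have key : ∀ ε : ℝ, 0 < ε → ‖f z‖ ≤ C * ‖1 + (ε : ℂ) * z‖ := by
    intro ε hε
    have hne : ∀ w : ℂ, 0 ≤ w.re → 1 + (ε : ℂ) * w ≠ 0 := fun w hw =>
      norm_pos_iff.1 (one_pos.trans_le (hone ε hε w hw).1)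
    have hbd : ∀ w : ℂ, 0 ≤ w.re → ‖(1 + (ε : ℂ) * w)⁻¹ • f w‖ ≤ K * (1 + 1 / ε) := by
      intro w hw
      obtain ⟨h1, h2⟩ := hone ε hε w hw
      rw [norm_smul, norm_inv, inv_mul_le_iff₀ (by linarith)]
      refine (hg w hw).trans ?_
      have : ‖w‖ ≤ ‖1 + (ε : ℂ) * w‖ * (1 / ε) := by
        rw [mul_one_div, le_div_iff₀ hε]
        linarith
      calc K * (1 + ‖w‖) ≤ K * (‖1 + (ε : ℂ) * w‖ + ‖1 + (ε : ℂ) * w‖ * (1 / ε)) := by gcongr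
        _ = _ := by ring
    have hcl : closure {w : ℂ | 0 < w.re} = {w | 0 ≤ w.re} := Complex.closure_setOfPred_lt_re 0
    have hd' : DiffContOnCl ℂ (fun w => (1 + (ε : ℂ) * w)⁻¹ • f w) {w | 0 < w.re} := by
      refine DiffContOnCl.smul (DiffContOnCl.inv ?_ fun w hw => ?_) hd
      · exact Differentiable.diffContOnCl (by fun_prop)
      · exact hne w (by rwa [hcl] at hw)
    have := PhragmenLindelof.right_half_plane_of_bounded_on_real (C := C) hd'
      ⟨1, one_lt_two, 0, ?_⟩ ?_ (fun t => ?_) hz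
    · rw [norm_smul, norm_inv, inv_mul_le_iff₀ (norm_pos_iff.2 (hne z hz))] at this
      linarith
    · refine Asymptotics.IsBigO.of_bound (K * (1 + 1 / ε)) ?_
      filter_upwards [mem_inf_of_right (mem_principal_self _)] with w hw
      simpa using hbd w (le_of_lt hw)
    · refine isBoundedUnder_of_eventually_le (a := K * (1 + 1 / ε)) ?_
      filter_upwards [eventually_ge_atTop 0] with t ht
      exact hbd t (by simpa using ht)
    · have h0 : 0 ≤ ((t : ℂ) * Complex.I).re := by simp
      rw [norm_smul, norm_inv]
      exact (mul_le_of_le_one_left (norm_nonneg _)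
        (inv_le_one_of_one_le₀ (hone ε hε _ h0).1)).trans (him t)
  have hlim : Tendsto (fun ε : ℝ => C * ‖1 + (ε : ℂ) * z‖) (𝓝[>] 0) (𝓝 C) := by
    have : Continuous fun ε : ℝ => C * ‖1 + (ε : ℂ) * z‖ := by fun_prop
    simpa using this.continuousAt (x := 0).tendsto.mono_left nhdsWithin_le_nhds
  exact ge_of_tendsto hlim (eventually_mem_nhdsWithin.mono fun ε hε => key ε hε)

/-- The closed left (`s = 1`) or right (`s = -1`) half-plane. -/
def halfPlane (s : ℤˣ) : Set ℂ := {l | ((s : ℤ) : ℝ) * l.re ≤ 0}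

theorem mem_halfPlane_of_re_eq_zero (s : ℤˣ) {l : ℂ} (hl : l.re = 0) : l ∈ halfPlane s := by
  simp [halfPlane, hl]

theorem isClosed_halfPlane (s : ℤˣ) : IsClosed (halfPlane s) :=
  isClosed_le (by fun_prop) continuous_const

theorem isPreconnected_halfPlane (s : ℤˣ) : IsPreconnected (halfPlane s) := by
  refine Convex.isPreconnected ?_
  have : IsLinearMap ℝ fun l : ℂ => ((s : ℤ) : ℝ) * l.re :=
    ⟨fun x y => by simp [mul_add], fun c x => by simp; ring⟩
  exact convex_halfSpace_le this 0

theorem sign_mul_self (s : ℤˣ) : ((s : ℤ) : ℂ) * ((s : ℤ) : ℂ) = 1 := by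
  rcases Int.units_eq_one_or s with rfl | rfl <;> simp

theorem norm_sign (s : ℤˣ) : ‖((s : ℤ) : ℂ)‖ = 1 := by
  rcases Int.units_eq_one_or s with rfl | rfl <;> simp

theorem neg_sign_mul_mem_halfPlane {s : ℤˣ} {w : ℂ} :
    -(((s : ℤ) : ℂ) * w) ∈ halfPlane s ↔ 0 ≤ w.re := by
  rcases Int.units_eq_one_or s with rfl | rfl <;> simp [halfPlane]

/-- The involution w ↦ -sw exchanges the closed right half-plane with `halfPlane s`. -/
theorem norm_le_of_mem_halfPlane {s : ℤˣ} {f : ℂ → E} {C K : ℝ}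
    (hd : DifferentiableOn ℂ f (interior (halfPlane s))) (hc : ContinuousOn f (halfPlane s))
    (hg : ∀ l ∈ halfPlane s, ‖f l‖ ≤ K * (1 + ‖l‖))
    (him : ∀ l : ℂ, l.re = 0 → ‖f l‖ ≤ C) {l : ℂ} (hl : l ∈ halfPlane s) : ‖f l‖ ≤ C := by
  have hmaps : Set.MapsTo (fun w : ℂ => -(((s : ℤ) : ℂ) * w)) {w | 0 ≤ w.re} (halfPlane s) :=
    fun w hw => neg_sign_mul_mem_halfPlane.2 hw
  have hcl : closure {w : ℂ | 0 < w.re} = {w | 0 ≤ w.re} := Complex.closure_setOfPred_lt_re 0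
  have hdf : Differentiable ℂ fun w : ℂ => -(((s : ℤ) : ℂ) * w) := by fun_prop
  have hd' : DiffContOnCl ℂ (fun w => f (-(((s : ℤ) : ℂ) * w))) {w | 0 < w.re} := by
    refine ⟨hd.comp hdf.differentiableOn ?_, ?_⟩
    · have hopen : IsOpen ((fun w : ℂ => -(((s : ℤ) : ℂ) * w)) ⁻¹' {w | 0 < w.re}) :=
        (isOpen_lt continuous_const Complex.continuous_re).preimage hdf.continuous
      intro w hw
      refine mem_interior.2 ⟨_, fun v hv => ?_, hopen, ?_⟩
      · have := neg_sign_mul_mem_halfPlane (s := s).2 (le_of_lt hv)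
        rwa [mul_neg, neg_neg, ← mul_assoc, sign_mul_self, one_mul] at this
      · simpa [← mul_assoc, sign_mul_self] using hw
    · rw [hcl]
      exact hc.comp hdf.continuous.continuousOn hmaps
  have heq : -(((s : ℤ) : ℂ) * -(((s : ℤ) : ℂ) * l)) = l := by
    rw [mul_neg, neg_neg, ← mul_assoc, sign_mul_self, one_mul]
  have := norm_le_of_re_nonneg_of_linear_growth (z := -(((s : ℤ) : ℂ) * l)) (C := C) (K := K) hd'
    (fun w hw => ?_) (fun t => him _ ?_) ?_
  · simpa only [heq] using this
  · have := hg _ (hmaps hw)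
    rwa [norm_neg, norm_mul, norm_sign, one_mul] at this
  · simp
  · rw [← neg_sign_mul_mem_halfPlane (s := s), heq]
    exact hl

end HalfPlane

/-! ### Bounded extensions and the resolvent of the restriction. -/

section Extension

variable {X : Type*} [NormedAddCommGroup X] [NormedSpace ℂ X] {S : X →ₗ.[ℂ] X}
  {s : ℤˣ} {x y : X} {φ ψ : ℂ → X} {l m : ℂ} {C : ℝ}

theorem mem_splitSpace : x ∈ splitSpace S s ↔ ∃ φ, IsBoundedExtension S (halfPlane s) x φ :=
  Iff.rfl

namespace IsBoundedExtension

theorem differentiableOn_interior (hφ : IsBoundedExtension S (halfPlane s) x φ) :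
    DifferentiableOn ℂ φ (interior (halfPlane s)) := fun l hl =>
  (hφ.1 l (Or.inl (interior_subset hl))).differentiableAt.differentiableWithinAt

theorem continuousOn (hφ : IsBoundedExtension S (halfPlane s) x φ) :
    ContinuousOn φ (halfPlane s) := fun l hl =>
  (hφ.1 l (Or.inl hl)).continuousAt.continuousWithinAt

/-- The formula comes from R(l)Sx = x + lR(l)x. A priori it grows linearly, but on the axis it is at
most C‖Sx‖, so Phragmén–Lindelöf makes it bounded. -/
theorem apply_domain {x : S.domain} (hφ : IsBoundedExtension S (halfPlane s) x φ)
    (hC : ∀ l : ℂ, l.re = 0 → l ∈ resolventSet S ∧ ‖resolvent S l‖ ≤ C) :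
    IsBoundedExtension S (halfPlane s) (S x) fun l => x + l • φ l := by
  have ha : AnalyticOnNhd ℂ (fun l => (x : X) + l • φ l) (halfPlane s ∪ resolventSet S) :=
    fun l hl => analyticAt_const.add (analyticAt_id.smul (hφ.1 l hl))
  have heq : ∀ l ∈ resolventSet S, (x : X) + l • φ l = resolvent S l (S x) := fun l hl => by
    rw [hφ.2.2 l hl, resolvent_apply hl]
  obtain ⟨K, hK⟩ := hφ.2.1
  refine ⟨ha, ⟨C * ‖S x‖, fun l hl => ?_⟩, heq⟩
  refine norm_le_of_mem_halfPlane (f := fun l => (x : X) + l • φ l) (K := ‖(x : X)‖ + K)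
    (fun l hl => (ha l (Or.inl (interior_subset hl))).differentiableAt.differentiableWithinAt)
    (fun l hl => (ha l (Or.inl hl)).continuousAt.continuousWithinAt)
    (fun l hl => ?_) (fun l hl => ?_) hl
  · have h1 : ‖l • φ l‖ ≤ ‖l‖ * K := by
      rw [norm_smul]
      exact mul_le_mul_of_nonneg_left (hK l hl) (norm_nonneg _)
    have h2 := norm_add_le (x : X) (l • φ l)
    have hK0 : 0 ≤ K := (norm_nonneg _).trans (hK l hl)
    nlinarith [norm_nonneg (x : X), norm_nonneg l,
      mul_nonneg (norm_nonneg (x : X)) (norm_nonneg l)]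
  · obtain ⟨h₁, h₂⟩ := hC l hl
    simp only [heq l h₁]
    exact ContinuousLinearMap.le_of_opNorm_le _ h₂ _

/-- The bound K of an individual extension is replaced by a constant independent of x; closedness of
G and continuity of the restricted resolvent rest on this. -/
theorem norm_le (hφ : IsBoundedExtension S (halfPlane s) x φ)
    (hC : ∀ l : ℂ, l.re = 0 → l ∈ resolventSet S ∧ ‖resolvent S l‖ ≤ C)
    (hl : l ∈ halfPlane s) : ‖φ l‖ ≤ C * ‖x‖ := by
  obtain ⟨K, hK⟩ := hφ.2.1
  have hK0 : 0 ≤ K := (norm_nonneg _).trans (hK l hl)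
  refine norm_le_of_mem_halfPlane hφ.differentiableOn_interior hφ.continuousOn (K := K)
    (fun l hl => (hK l hl).trans (le_mul_of_one_le_right hK0 (by simp))) (fun l hl => ?_) hl
  obtain ⟨h₁, h₂⟩ := hC l hl
  rw [hφ.2.2 l h₁]
  exact ContinuousLinearMap.le_of_opNorm_le _ h₂ _

end IsBoundedExtension

theorem isInvariant_splitSpace
    (hC : ∀ l : ℂ, l.re = 0 → l ∈ resolventSet S ∧ ‖resolvent S l‖ ≤ C) (s : ℤˣ) :
    IsInvariant S (splitSpace S s) := fun _ ⟨_, hφ⟩ =>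
  ⟨_, IsBoundedExtension.apply_domain hφ hC⟩

variable [CompleteSpace X]

/-- Analytic functions on the half-plane that agree on the resolvent set agree. -/
theorem eqOn_halfPlane (h0 : (0 : ℂ) ∈ resolventSet S) {f g : ℂ → X}
    (hf : AnalyticOnNhd ℂ f (halfPlane s)) (hg : AnalyticOnNhd ℂ g (halfPlane s))
    (h : Set.EqOn f g (resolventSet S)) : Set.EqOn f g (halfPlane s ∪ resolventSet S) :=
  (hf.eqOn_of_preconnected_of_eventuallyEq hg (isPreconnected_halfPlane s)
    (mem_halfPlane_of_re_eq_zero s Complex.zero_re)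
    (Filter.mem_of_superset (isOpen_resolventSet.mem_nhds h0) h)).union h

namespace IsBoundedExtension

theorem eqOn (hφ : IsBoundedExtension S (halfPlane s) x φ)
    (hψ : IsBoundedExtension S (halfPlane s) x ψ) (h0 : (0 : ℂ) ∈ resolventSet S) :
    Set.EqOn φ ψ (halfPlane s ∪ resolventSet S) :=
  eqOn_halfPlane h0 (hφ.1.mono Set.subset_union_left) (hψ.1.mono Set.subset_union_left)
    fun l hl => (hφ.2.2 l hl).trans (hψ.2.2 l hl).symm

/-- Rewriting (S - l)φ(l) = x with S⁻¹ leaves only bounded operators, so the identity continues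
analytically and shows that φ(l) lies in the domain of S. -/
theorem eq_resolvent_zero (hφ : IsBoundedExtension S (halfPlane s) x φ)
    (h0 : (0 : ℂ) ∈ resolventSet S) (hl : l ∈ halfPlane s ∪ resolventSet S) :
    φ l = resolvent S 0 (x + l • φ l) := by
  have ha : AnalyticOnNhd ℂ φ (halfPlane s) := hφ.1.mono Set.subset_union_left
  refine eqOn_halfPlane h0 (g := fun l => resolvent S 0 (x + l • φ l)) ha
    (fun l hl => ((resolvent S 0).analyticAt _).fun_comp
      (analyticAt_const.add (analyticAt_id.smul (ha l hl)))) (fun l hl => ?_) hl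
  simp only [hφ.2.2 l hl]
  rw [map_add, map_smul, ← resolvent_comm hl h0]
  simpa using resolvent_eq_add hl h0 x

theorem mem_domain (hφ : IsBoundedExtension S (halfPlane s) x φ)
    (h0 : (0 : ℂ) ∈ resolventSet S) (hl : l ∈ halfPlane s ∪ resolventSet S) :
    φ l ∈ S.domain := by
  rw [hφ.eq_resolvent_zero h0 hl]
  exact resolvent_mem_domain h0 _

theorem apply_eq (hφ : IsBoundedExtension S (halfPlane s) x φ)
    (h0 : (0 : ℂ) ∈ resolventSet S) (hl : l ∈ halfPlane s ∪ resolventSet S) :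
    S ⟨φ l, hφ.mem_domain h0 hl⟩ = x + l • φ l := by
  have h := apply_resolvent h0 (x + l • φ l)
  rw [zero_smul, add_zero] at h
  rw [← h]
  congr 1
  exact Subtype.ext (hφ.eq_resolvent_zero h0 hl)

/-- The difference quotients of an extension at `m` form an extension for its value at `m`. -/
theorem dslope (hφ : IsBoundedExtension S (halfPlane s) x φ)
    (h0 : (0 : ℂ) ∈ resolventSet S) (hm : m ∈ halfPlane s ∪ resolventSet S) :
    IsBoundedExtension S (halfPlane s) (φ m) (dslope φ m) := by
  have hU : IsOpen {l | AnalyticAt ℂ φ l} := isOpen_analyticAt ℂ φ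
  have hda : AnalyticOnNhd ℂ (_root_.dslope φ m) {l | AnalyticAt ℂ φ l} :=
    ((Complex.differentiableOn_dslope (hU.mem_nhds (hφ.1 m hm))).2 fun l hl =>
      hl.differentiableAt.differentiableWithinAt).analyticOnNhd hU
  have ha : AnalyticOnNhd ℂ (_root_.dslope φ m) (halfPlane s ∪ resolventSet S) :=
    hda.mono hφ.1
  have hne : ∀ l ∈ resolventSet S, l ≠ m → _root_.dslope φ m l = resolvent S l (φ m) := by
    intro l hl hlm
    have hlm' : l - m ≠ 0 := sub_ne_zero.2 hlm
    have h := resolvent_apply hl ⟨φ m, hφ.mem_domain h0 hm⟩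
    rw [hφ.apply_eq h0 hm, map_add, map_smul, ← hφ.2.2 l hl] at h
    rw [dslope_of_ne _ hlm, slope_def_module, inv_smul_eq_iff₀ hlm']
    linear_combination (norm := module) h
  refine ⟨ha, ?_, fun l hl => ?_⟩
  · obtain ⟨K, hK⟩ := hφ.2.1
    obtain ⟨L, hL⟩ := ((isCompact_closedBall m 1).inter_left
      (isClosed_halfPlane s)).exists_bound_of_continuousOn (f := _root_.dslope φ m)
      -- Compactness bounds the difference quotient within distance 1 of m; farther away the
      -- denominator exceeds 1.
      fun l hl => (ha l (Or.inl hl.1)).continuousAt.continuousWithinAt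
    refine ⟨max L (K + ‖φ m‖), fun l hl => ?_⟩
    by_cases hlm : ‖l - m‖ ≤ 1
    · exact (hL l ⟨hl, by simpa [dist_eq_norm] using hlm⟩).trans (le_max_left _ _)
    · have hlm : 1 < ‖l - m‖ := not_le.1 hlm
      have hne' : l ≠ m := fun h => by simp [h] at hlm; linarith
      rw [dslope_of_ne _ hne', slope_def_module, norm_smul, norm_inv]
      refine (mul_le_of_le_one_left (norm_nonneg _) (inv_le_one_of_one_le₀ hlm.le)).trans ?_
      exact ((norm_sub_le _ _).trans (by gcongr; exact hK l hl)).trans (le_max_right _ _)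
  · by_cases hlm : l = m
    · subst hlm
      have h₁ : Tendsto (_root_.dslope φ l) (𝓝[≠] l) (𝓝 (_root_.dslope φ l l)) :=
        (ha l hm).continuousAt.tendsto.mono_left nhdsWithin_le_nhds
      have h₂ : Tendsto (fun k => resolvent S k (φ l)) (𝓝[≠] l) (𝓝 (resolvent S l (φ l))) :=
        (analyticAt_resolvent_apply hl _).continuousAt.tendsto.mono_left nhdsWithin_le_nhds
      refine tendsto_nhds_unique (h₁.congr' ?_) h₂
      filter_upwards [self_mem_nhdsWithin,
        nhdsWithin_le_nhds (isOpen_resolventSet.mem_nhds hl)] with k hk hk'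
      exact hne k hk' hk
    · exact hne l hl hlm

end IsBoundedExtension

/-- By the uniform bound C‖x‖, extensions belonging to a convergent sequence are uniformly Cauchy on
the half-plane. The limit is analytic in the interior, and the boundary lies in the resolvent set.
-/
theorem isClosed_splitSpace
    (hC : ∀ l : ℂ, l.re = 0 → l ∈ resolventSet S ∧ ‖resolvent S l‖ ≤ C) (s : ℤˣ) :
    IsClosed (splitSpace S s : Set X) := by
  classical
  have h0 := (hC 0 Complex.zero_re).1
  refine isClosed_of_closure_subset fun x hx => ?_
  obtain ⟨u, hu, hux⟩ := mem_closure_iff_seq_limit.1 hx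
  choose φ hφ using fun n => mem_splitSpace.1 (hu n)
  have hdiff : ∀ n k, ∀ l ∈ halfPlane s, ‖φ n l - φ k l‖ ≤ C * ‖u n - u k‖ := by
    intro n k l hl
    obtain ⟨ψ, hψ⟩ := mem_splitSpace.1 (Submodule.sub_mem _ (hu n) (hu k))
    have : Set.EqOn ψ (fun l => φ n l - φ k l) (halfPlane s ∪ resolventSet S) :=
      eqOn_halfPlane h0 (hψ.1.mono Set.subset_union_left)
        (((hφ n).1.sub (hφ k).1).mono Set.subset_union_left) fun l hl => by
          simp only [hψ.2.2 l hl, (hφ n).2.2 l hl, (hφ k).2.2 l hl, map_sub]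
    have h := hψ.norm_le hC hl
    rwa [this (Or.inl hl)] at h
  have hC0 : 0 ≤ C := (norm_nonneg _).trans (hC 0 Complex.zero_re).2
  have hcau : UniformCauchySeqOn φ atTop (halfPlane s) := by
    rw [Metric.uniformCauchySeqOn_iff]
    intro ε hε
    obtain ⟨N, hN⟩ := Metric.cauchySeq_iff.1 hux.cauchySeq (ε / (C + 1)) (by positivity)
    refine ⟨N, fun n hn k hk l hl => ?_⟩
    rw [dist_eq_norm]
    have := hN n hn k hk
    rw [dist_eq_norm, lt_div_iff₀ (by positivity)] at this
    nlinarith [hdiff n k l hl, norm_nonneg (u n - u k)]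
  have hlim : ∀ l ∈ halfPlane s, ∃ v, Tendsto (fun n => φ n l) atTop (𝓝 v) := fun l hl =>
    cauchySeq_tendsto_of_complete (hcau.cauchySeq hl)
  choose! g hg using hlim
  have hunif : TendstoUniformlyOn φ g atTop (halfPlane s) :=
    hcau.tendstoUniformlyOn_of_tendsto hg
  have hgR : ∀ l ∈ halfPlane s, l ∈ resolventSet S → g l = resolvent S l x := by
    intro l hl hl'
    refine tendsto_nhds_unique (hg l hl) ?_
    refine Tendsto.congr (fun n => ((hφ n).2.2 l hl').symm) ?_
    exact ((resolvent S l).continuous.tendsto x).comp hux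
  have hgd : DifferentiableOn ℂ g (interior (halfPlane s)) :=
    (hunif.mono interior_subset).tendstoLocallyUniformlyOn.differentiableOn
      (Eventually.of_forall fun n => (hφ n).differentiableOn_interior) isOpen_interior
  let ψ : ℂ → X := fun l => if l ∈ resolventSet S then resolvent S l x else g l
  have hψR : ∀ l ∈ resolventSet S, ψ l = resolvent S l x := fun l hl => if_pos hl
  have hψg : Set.EqOn ψ g (halfPlane s) := fun l hl => by
    by_cases h : l ∈ resolventSet S
    · rw [hψR l h, hgR l hl h]
    · exact if_neg h
  have hR : AnalyticOnNhd ℂ ψ (resolventSet S) := fun l hl =>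
    (analyticAt_resolvent_apply hl x).congr
      (Filter.mem_of_superset (isOpen_resolventSet.mem_nhds hl) fun k hk => (hψR k hk).symm)
  refine ⟨ψ, ?_, ?_, hψR⟩
  · rintro l (hl | hl)
    · by_cases h : l ∈ interior (halfPlane s)
      · exact (hgd.analyticOnNhd isOpen_interior l h).congr (Filter.mem_of_superset
          (isOpen_interior.mem_nhds h) fun k hk => (hψg (interior_subset hk)).symm)
      · refine hR l (hC l ?_).1
        by_contra hre
        refine h (mem_interior.2 ⟨{k | ((s : ℤ) : ℝ) * k.re < 0}, fun k hk => ?_,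
          isOpen_lt (by fun_prop) continuous_const, ?_⟩)
        · exact le_of_lt (show ((s : ℤ) : ℝ) * k.re < 0 from hk)
        · exact lt_of_le_of_ne (show ((s : ℤ) : ℝ) * l.re ≤ 0 from hl) (by simp [hre])
    · exact hR l hl
  · refine ⟨C * ‖x‖, fun l hl => ?_⟩
    rw [hψg hl]
    exact le_of_tendsto_of_tendsto' (hg l hl).norm (hux.norm.const_mul C)
      fun n => (hφ n).norm_le hC hl

/-- The resolvent of `S|G` is given by the extensions, on the half-plane and on `ϱ(S)`. -/
theorem exists_isResolventAt_restrictOp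
    (hC : ∀ l : ℂ, l.re = 0 → l ∈ resolventSet S ∧ ‖resolvent S l‖ ≤ C)
    (hG : IsInvariant S (splitSpace S s)) (hm : m ∈ halfPlane s ∪ resolventSet S) :
    ∃ R : splitSpace S s →L[ℂ] splitSpace S s, IsResolventAt (restrictOp S _ hG) m R ∧
      ∀ (x : splitSpace S s) φ, IsBoundedExtension S (halfPlane s) x φ → (R x : X) = φ m := by
  have h0 := (hC 0 Complex.zero_re).1
  choose Φ hΦ using fun x : splitSpace S s => mem_splitSpace.1 x.2
  have huniq : ∀ (x : splitSpace S s) φ, IsBoundedExtension S (halfPlane s) x φ →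
      Φ x m = φ m := fun x φ hφ => (hΦ x).eqOn hφ h0 hm
  have hbound : ∀ x, ‖Φ x m‖ ≤ max C ‖resolvent S m‖ * ‖x‖ := by
    intro x
    rcases hm with hm | hm
    · exact ((hΦ x).norm_le hC hm).trans
        (mul_le_mul_of_nonneg_right (le_max_left _ _) (norm_nonneg _))
    · rw [(hΦ x).2.2 m hm]
      exact ContinuousLinearMap.le_of_opNorm_le _ (le_max_right _ _) _
  let R : splitSpace S s →ₗ[ℂ] splitSpace S s :=
    -- The value at m stays in G, with the difference quotients as its extension.
    { toFun := fun x => ⟨Φ x m, _, (hΦ x).dslope h0 hm⟩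
      map_add' := fun x y => Subtype.ext (huniq (x + y) (fun l => Φ x l + Φ y l)
        ⟨(hΦ x).1.add (hΦ y).1, by
          obtain ⟨K, hK⟩ := (hΦ x).2.1
          obtain ⟨L, hL⟩ := (hΦ y).2.1
          exact ⟨K + L, fun l hl => (norm_add_le _ _).trans (add_le_add (hK l hl) (hL l hl))⟩,
          fun l hl => by simp [(hΦ x).2.2 l hl, (hΦ y).2.2 l hl]⟩)
      map_smul' := fun c x => Subtype.ext (huniq (c • x) (fun l => c • Φ x l)
        ⟨fun l hl => ((hΦ x).1 l hl).const_smul, by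
          obtain ⟨K, hK⟩ := (hΦ x).2.1
          exact ⟨‖c‖ * K, fun l hl => by
            rw [norm_smul]
            exact mul_le_mul_of_nonneg_left (hK l hl) (norm_nonneg c)⟩,
          fun l hl => by simp [(hΦ x).2.2 l hl]⟩) }
  refine ⟨R.mkContinuous _ hbound, ⟨fun y => ⟨(hΦ y).mem_domain h0 hm, ?_⟩, fun x => ?_⟩, huniq⟩
  · refine Subtype.ext ?_
    change S ⟨Φ y m, _⟩ - m • Φ y m = y
    rw [(hΦ y).apply_eq h0 hm, add_sub_cancel_right]
  · rw [map_sub, map_smul]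
    refine Subtype.ext ?_
    change Φ (restrictOp S _ hG x) m - m • Φ x m = ((x : splitSpace S s) : X)
    have := huniq (restrictOp S _ hG x) _
      (IsBoundedExtension.apply_domain (x := ⟨((x : splitSpace S s) : X), x.2⟩) (hΦ x) hC)
    rw [this, add_sub_cancel_right]

/-- Since s² = 1, sT - l = s(T - sl). -/
theorem IsResolventAt.units_smul {Y : Type*} [NormedAddCommGroup Y] [NormedSpace ℂ Y]
    {T : Y →ₗ.[ℂ] Y} {R : Y →L[ℂ] Y} (h : IsResolventAt T (((s : ℤ) : ℂ) * l) R) :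
    IsResolventAt (s • T) l (((s : ℤ) : ℂ) • R) := by
  rcases Int.units_eq_one_or s with rfl | rfl
  · rw [one_smul]
    simpa using h
  · have hT : (-1 : ℤˣ) • T = -T := by
      rw [Units.smul_def, Units.val_neg, Units.val_one, neg_one_zsmul]
    rw [hT]
    simp only [Units.val_neg, Units.val_one, Int.cast_neg, Int.cast_one, neg_mul, one_mul,
      neg_smul, one_smul] at h ⊢
    refine ⟨fun y => ?_, fun x => ?_⟩
    · obtain ⟨hy, hy'⟩ := h.1 y
      refine ⟨T.domain.neg_mem hy, ?_⟩
      change -T (-⟨R y, hy⟩) - l • (-R y) = y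
      rw [T.map_neg, neg_neg]
      linear_combination (norm := module) hy'
    · have hx := h.2 x
      change -R (-T x - l • (x : Y)) = x
      rw [← map_neg]
      refine Eq.trans (congrArg R ?_) hx
      module

/-- Reduces each sectorial estimate to a pointwise bound on extensions at sl. -/
theorem resolvent_smul_restrictOp
    (hC : ∀ l : ℂ, l.re = 0 → l ∈ resolventSet S ∧ ‖resolvent S l‖ ≤ C)
    (hG : IsInvariant S (splitSpace S s))
    (hl : ((s : ℤ) : ℂ) * l ∈ halfPlane s ∪ resolventSet S) {b : ℝ} (hb : 0 ≤ b)
    (h : ∀ x φ, IsBoundedExtension S (halfPlane s) x φ → ‖φ (((s : ℤ) : ℂ) * l)‖ ≤ b * ‖x‖) :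
    l ∈ resolventSet (s • restrictOp S (splitSpace S s) hG) ∧
      ‖resolvent (s • restrictOp S (splitSpace S s) hG) l‖ ≤ b := by
  obtain ⟨R, hR, hRφ⟩ := exists_isResolventAt_restrictOp hC hG hl
  have hs := hR.units_smul
  refine ⟨⟨_, hs⟩, ?_⟩
  rw [hs.resolvent_eq, norm_smul, norm_sign, one_mul]
  refine ContinuousLinearMap.opNorm_le_bound _ hb fun x => ?_
  obtain ⟨φ, hφ⟩ := mem_splitSpace.1 x.2
  have := h x φ hφ
  rwa [← hRφ x φ hφ] at this

end Extension

/-! ### Sectorial estimates with the original constants. -/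

section Sectoriality

/-- Removes the argument, making the symmetry under z ↦ -z evident. -/
theorem mem_bisector_iff {θ : ℝ} (hθ0 : 0 < θ) (hθ : θ < Real.pi / 2) {z : ℂ} :
    z ∈ bisector θ ↔ |z.re| < ‖z‖ * Real.cos θ := by
  have hre : ‖z‖ * Real.cos |z.arg| = z.re := by rw [Real.cos_abs, Complex.norm_mul_cos_arg]
  have hπ : Real.cos (Real.pi - θ) = -Real.cos θ := Real.cos_pi_sub θ
  constructor
  · rintro ⟨h₁, h₂⟩
    have hz : 0 < ‖z‖ := by
      rw [norm_pos_iff]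
      rintro rfl
      simp at h₁
      linarith
    have h₃ := Real.cos_lt_cos_of_nonneg_of_le_pi hθ0.le (Complex.abs_arg_le_pi z) h₁
    have h₄ := Real.cos_lt_cos_of_nonneg_of_le_pi (abs_nonneg z.arg)
      (by linarith : Real.pi - θ ≤ Real.pi) h₂
    rw [hπ] at h₄
    rw [abs_lt, ← hre]
    constructor <;> nlinarith
  · intro h
    rw [abs_lt, ← hre] at h
    have hz : 0 ≤ ‖z‖ := norm_nonneg z
    constructor
    · by_contra! hlt
      have := Real.cos_le_cos_of_nonneg_of_le_pi (abs_nonneg z.arg) (by linarith) hlt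
      nlinarith
    · by_contra! hlt
      have := Real.cos_le_cos_of_nonneg_of_le_pi (by linarith) (Complex.abs_arg_le_pi z) hlt
      rw [hπ] at this
      nlinarith

theorem sign_mul_mem_halfPlane (s : ℤˣ) {l : ℂ} (hl : l.re ≤ 0) :
    ((s : ℤ) : ℂ) * l ∈ halfPlane s := by
  have := neg_sign_mul_mem_halfPlane (s := s) (w := -l).2 (by simpa using hl)
  simpa using this

theorem re_neg_sign_mul_pos_of_mem_interior {s : ℤˣ} {l : ℂ} (hl : l ∈ interior (halfPlane s)) :
    0 < (-(((s : ℤ) : ℂ) * l)).re := by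
  rcases Int.units_eq_one_or s with rfl | rfl
  · have h : halfPlane 1 = {z | z.re ≤ 0} := by ext; simp [halfPlane]
    rw [h, Complex.interior_setOfPred_re_le] at hl
    simpa using hl
  · have h : halfPlane (-1) = {z | 0 ≤ z.re} := by ext; simp [halfPlane]
    rw [h, Complex.interior_setOfPred_le_re] at hl
    simpa using hl

theorem re_neg_sign_mul_nonneg {s : ℤˣ} {l : ℂ} (hl : l ∈ halfPlane s) :
    0 ≤ (-(((s : ℤ) : ℂ) * l)).re := by
  rcases Int.units_eq_one_or s with rfl | rfl <;> simpa [halfPlane] using hl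

variable {X : Type*} [NormedAddCommGroup X] [NormedSpace ℂ X] {S : X →ₗ.[ℂ] X}
  {s : ℤˣ} {x : X} {φ : ℂ → X} {l : ℂ} {C M β θ : ℝ}

/-- A power bound for the resolvent on the imaginary axis extends to the half-plane, with the same
constant. -/
theorem IsBoundedExtension.norm_le_div_rpow (hφ : IsBoundedExtension S (halfPlane s) x φ)
    (hβ0 : 0 < β) (hβ1 : β ≤ 1)
    (hM : ∀ l : ℂ, l.re = 0 → l ≠ 0 → l ∈ resolventSet S ∧ ‖resolvent S l‖ ≤ M / ‖l‖ ^ β)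
    (hl : l ∈ halfPlane s) (hl0 : l ≠ 0) : ‖φ l‖ ≤ M / ‖l‖ ^ β * ‖x‖ := by
  obtain ⟨K, hK⟩ := hφ.2.1
  have hK0 : 0 ≤ K := (norm_nonneg _).trans (hK l hl)
  have hM0 : 0 ≤ M := by
    have := (norm_nonneg _).trans (hM Complex.I (by simp) Complex.I_ne_zero).2
    simpa using this
  -- The base of the power lies in the closed right half-plane, where the principal branch is
  -- continuous (at 0 because β > 0) and has modulus |k|^β.
  set f : ℂ → X := fun k => (-(((s : ℤ) : ℂ) * k)) ^ (β : ℂ) • φ k with hf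
  have hnorm : ∀ k, ‖f k‖ = ‖k‖ ^ β * ‖φ k‖ := fun k => by
    rw [hf, norm_smul, Complex.norm_cpow_real, norm_neg, norm_mul, norm_sign, one_mul]
  have hmain : ‖f l‖ ≤ M * ‖x‖ := by
    refine norm_le_of_mem_halfPlane (s := s) (K := K) (fun k hk => ?_) (fun k hk => ?_)
      (fun k hk => ?_) (fun k hk => ?_) hl
    · refine DifferentiableWithinAt.smul ?_ (hφ.differentiableOn_interior k hk)
      exact DifferentiableAt.differentiableWithinAt (DifferentiableAt.cpow_const (by fun_prop)
        (Or.inl (re_neg_sign_mul_pos_of_mem_interior hk)))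
    · refine ContinuousWithinAt.smul ?_ (hφ.continuousOn k hk)
      refine ContinuousAt.continuousWithinAt ?_
      exact ContinuousAt.comp (g := fun z : ℂ => z ^ (β : ℂ))
        (f := fun k : ℂ => -(((s : ℤ) : ℂ) * k))
        (Complex.continuousAt_cpow_const_of_re_pos (Or.inl (re_neg_sign_mul_nonneg hk))
          (by simpa using hβ0)) (by fun_prop)
    · rw [hnorm, mul_comm]
      have h1 : ‖k‖ ^ β ≤ 1 + ‖k‖ := calc
        ‖k‖ ^ β ≤ (1 + ‖k‖) ^ β := by gcongr; linarith
        _ ≤ (1 + ‖k‖) ^ (1 : ℝ) :=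
          Real.rpow_le_rpow_of_exponent_le (by linarith [norm_nonneg k]) hβ1
        _ = 1 + ‖k‖ := Real.rpow_one _
      exact mul_le_mul (hK k hk) h1 (by positivity) hK0
    · rw [hnorm]
      by_cases hk0 : k = 0
      · rw [hk0, norm_zero, Real.zero_rpow hβ0.ne', zero_mul]
        positivity
      · obtain ⟨h₁, h₂⟩ := hM k hk hk0
        have hpos : 0 < ‖k‖ ^ β := Real.rpow_pos_of_pos (norm_pos_iff.2 hk0) β
        rw [hφ.2.2 k h₁]
        calc ‖k‖ ^ β * ‖resolvent S k x‖ ≤ ‖k‖ ^ β * (M / ‖k‖ ^ β * ‖x‖) := by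
              gcongr
              exact ContinuousLinearMap.le_of_opNorm_le _ h₂ _
          _ = M * ‖x‖ := by field_simp
  have hpos : 0 < ‖l‖ ^ β := Real.rpow_pos_of_pos (norm_pos_iff.2 hl0) β
  rw [hnorm] at hmain
  rw [div_mul_eq_mul_div, le_div_iff₀ hpos]
  linarith

variable [CompleteSpace X]

theorem IsAlmostBisectorialWith.isAlmostSectorialWith (h : IsAlmostBisectorialWith S M β)
    (hC : ∀ l : ℂ, l.re = 0 → l ∈ resolventSet S ∧ ‖resolvent S l‖ ≤ C)
    (hG : IsInvariant S (splitSpace S s)) :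
    IsAlmostSectorialWith (s • restrictOp S (splitSpace S s) hG) (Real.pi / 2) M β := by
  obtain ⟨hβ0, hβ1, hM0, hM⟩ := h
  have hπ := Real.pi_pos
  have key : ∀ l : ℂ, l ∉ sector (Real.pi / 2) →
      l ∈ resolventSet (s • restrictOp S (splitSpace S s) hG) ∧
        ‖resolvent (s • restrictOp S (splitSpace S s) hG) l‖ ≤ M / ‖l‖ ^ β := by
    intro l hl
    have hre : l.re < 0 := by
      by_contra! h
      exact hl (Complex.abs_arg_le_pi_div_two_iff.2 h)
    have hl0 : l ≠ 0 := fun h => by simp [h] at hre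
    refine resolvent_smul_restrictOp hC hG (Or.inl (sign_mul_mem_halfPlane s hre.le))
      (by positivity) fun x φ hφ => ?_
    have hs0 : ((s : ℤ) : ℂ) * l ≠ 0 := by
      rw [← norm_pos_iff, norm_mul, norm_sign, one_mul]
      exact norm_pos_iff.2 hl0
    have := hφ.norm_le_div_rpow hβ0 hβ1.le hM (sign_mul_mem_halfPlane s hre.le) hs0
    rwa [norm_mul, norm_sign, one_mul] at this
  refine ⟨hβ0, hβ1, by positivity, by linarith, hM0, fun l hl => ?_, fun l hl => (key l hl).2⟩
  by_contra hl'
  exact hl (key l hl').1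

/-- Outside the sector, either Re l ≤ 0, where Phragmén–Lindelöf with exponent 1 applies, or l lies
in the bisector, where the extension is the resolvent of S itself. -/
theorem IsBisectorialOn.isSectorialWith (h : IsBisectorialOn S θ M)
    (hC : ∀ l : ℂ, l.re = 0 → l ∈ resolventSet S ∧ ‖resolvent S l‖ ≤ C)
    (hG : IsInvariant S (splitSpace S s)) :
    IsSectorialWith (s • restrictOp S (splitSpace S s) hG) θ M := by
  obtain ⟨hθ0, hθ, hM0, hM⟩ := h
  have hπ := Real.pi_pos
  have hcos : 0 < Real.cos θ := Real.cos_pos_of_mem_Ioo ⟨by linarith, hθ⟩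
  have key : ∀ l : ℂ, l ∉ sector θ →
      l ∈ resolventSet (s • restrictOp S (splitSpace S s) hG) ∧
        ‖resolvent (s • restrictOp S (splitSpace S s) hG) l‖ ≤ M / ‖l‖ := by
    intro l hl
    have hl' : θ < |l.arg| := not_le.1 hl
    have hl0 : l ≠ 0 := fun h => by simp [h] at hl'; linarith
    have hs0 : ((s : ℤ) : ℂ) * l ≠ 0 := by
      rw [← norm_pos_iff, norm_mul, norm_sign, one_mul]
      exact norm_pos_iff.2 hl0
    have hns : ‖((s : ℤ) : ℂ) * l‖ = ‖l‖ := by rw [norm_mul, norm_sign, one_mul]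
    rcases le_or_gt l.re 0 with hre | hre
    · refine resolvent_smul_restrictOp hC hG (Or.inl (sign_mul_mem_halfPlane s hre))
        (by positivity) fun x φ hφ => ?_
      have := hφ.norm_le_div_rpow (M := M) (β := 1) one_pos le_rfl (fun k hk hk0 => ?_)
        (sign_mul_mem_halfPlane s hre) hs0
      · rwa [Real.rpow_one, hns] at this
      · rw [Real.rpow_one]
        refine hM k ((mem_bisector_iff hθ0 hθ).2 ?_)
        rw [hk, abs_zero]
        exact mul_pos (norm_pos_iff.2 hk0) hcos
    · have hb : l ∈ bisector θ := by
        refine ⟨hl', ?_⟩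
        have := Complex.abs_arg_lt_pi_div_two_iff.2 (Or.inl hre)
        linarith
      have hsb : ((s : ℤ) : ℂ) * l ∈ bisector θ := by
        rw [mem_bisector_iff hθ0 hθ] at hb ⊢
        rw [hns]
        rcases Int.units_eq_one_or s with rfl | rfl <;> simpa using hb
      obtain ⟨h₁, h₂⟩ := hM _ hsb
      rw [hns] at h₂
      refine resolvent_smul_restrictOp hC hG (Or.inr h₁) (by positivity) fun x φ hφ => ?_
      rw [hφ.2.2 _ h₁]
      exact ContinuousLinearMap.le_of_opNorm_le _ h₂ _
  refine ⟨hθ0, by linarith, hM0, fun l hl => ?_, fun l hl => (key l hl).2⟩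
  by_contra hl'
  exact hl (key l hl').1

theorem IsBisectorial.exists_isBisectorialOn (h : IsBisectorial S) :
    ∃ θ M : ℝ, IsBisectorialOn S θ M := by
  obtain ⟨M, hM0, hM⟩ := h
  -- With tan θ = 2M, every l in the bisector has |Im l| ≥ ‖l‖ sin θ = 2M‖l‖ cos θ ≥ 2M|Re l|, so
  -- the Neumann series around i Im l has ratio at most 1/2.
  set θ := Real.arctan (2 * M) with hθ
  have hθ0 : 0 < θ := Real.arctan_pos.2 (by positivity)
  have hθ1 : θ < Real.pi / 2 := Real.arctan_lt_pi_div_two _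
  have hcos : 0 < Real.cos θ := Real.cos_arctan_pos _
  have hsin : Real.sin θ = 2 * M * Real.cos θ := by
    rw [← Real.tan_mul_cos hcos.ne', hθ, Real.tan_arctan]
  have hsin0 : 0 < Real.sin θ := by rw [hsin]; positivity
  refine ⟨θ, 2 * M / Real.sin θ, hθ0, hθ1, by positivity, fun l hl => ?_⟩
  rw [mem_bisector_iff hθ0 hθ1] at hl
  have hl0 : 0 < ‖l‖ := by
    by_contra! h
    have := norm_le_zero_iff.1 h
    simp [this] at hl
  have him : ‖l‖ * Real.sin θ ≤ |l.im| := by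
    refine (sq_le_sq₀ (by positivity) (abs_nonneg _)).1 ?_
    have h1 : ‖l‖ ^ 2 = |l.re| ^ 2 + |l.im| ^ 2 := by
      rw [← Complex.normSq_eq_norm_sq, Complex.normSq_apply, sq_abs, sq_abs]
      ring
    have h2 : |l.re| ^ 2 ≤ (‖l‖ * Real.cos θ) ^ 2 := by gcongr
    have h3 := Real.sin_sq_add_cos_sq θ
    have h4 : (‖l‖ * Real.sin θ) ^ 2 = ‖l‖ ^ 2 - (‖l‖ * Real.cos θ) ^ 2 := by
      rw [mul_pow, mul_pow]
      linear_combination ‖l‖ ^ 2 * h3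
    linarith
  have him0 : 0 < |l.im| := lt_of_lt_of_le (by positivity) him
  obtain ⟨h₁, h₂⟩ := hM (l.im * Complex.I) (by simp) (by simpa using abs_pos.1 him0)
  have hn : ‖(l.im : ℂ) * Complex.I‖ = |l.im| := by simp
  rw [hn] at h₂
  have hsub : l - l.im * Complex.I = l.re := by
    rw [sub_eq_iff_eq_add, Complex.re_add_im]
  obtain ⟨h₃, h₄⟩ := norm_resolvent_le_of_norm_le_half (l := l) h₁ h₂ (by
    rw [hsub, Complex.norm_real, Real.norm_eq_abs, mul_div_assoc', div_le_iff₀ him0]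
    rw [hsin] at him
    nlinarith)
  refine ⟨h₃, h₄.trans ?_⟩
  rw [div_div, mul_div_assoc']
  gcongr
  linarith

end Sectoriality

/-! ### Integrals along vertical lines. -/

section Lines

variable {E : Type*} [NormedAddCommGroup E]

theorem integrable_of_norm_le_div_rpow {g : ℝ → E} {r K D : ℝ} (hg : Continuous g) (hr : 1 < r)
    (hK : ∀ t, ‖g t‖ ≤ K) (hD : ∀ t, 1 ≤ |t| → ‖g t‖ ≤ D / |t| ^ r) : Integrable g := by
  have hint : Integrable fun t : ℝ => (1 + ‖t‖) ^ (-r) :=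
    integrable_one_add_norm (by simpa using hr)
  have hK0 : 0 ≤ K := (norm_nonneg _).trans (hK 0)
  have hD0 : 0 ≤ D := by simpa using (norm_nonneg _).trans (hD 1 (by simp))
  refine (hint.const_mul ((K + D) * 2 ^ r)).mono' hg.aestronglyMeasurable
    (Eventually.of_forall fun t => ?_)
  have ht : 0 ≤ |t| := abs_nonneg t
  -- The factor 2^r rescales to (1 + |t|)/2, which is at most |t| when |t| ≥ 1 and at most 1 when
  -- |t| ≤ 1.
  have hq : (K + D) * 2 ^ r * (1 + ‖t‖) ^ (-r) = (K + D) / ((1 + |t|) / 2) ^ r := by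
    rw [Real.norm_eq_abs, Real.rpow_neg (by positivity), Real.div_rpow (by positivity) (by simp)]
    field_simp
  rw [hq]
  have hpos : 0 < ((1 + |t|) / 2) ^ r := by positivity
  rcases le_total 1 |t| with h1 | h1
  · refine (hD t h1).trans ?_
    gcongr <;> linarith
  · refine (hK t).trans ((show K ≤ K + D by linarith).trans (le_div_self (by positivity) hpos ?_))
    exact Real.rpow_le_one (by positivity) (by linarith) (by linarith)

theorem continuous_line (a : ℝ) : Continuous fun t : ℝ => (a : ℂ) + (t : ℂ) * Complex.I := by
  fun_prop

theorem abs_le_norm_line (a t : ℝ) : |t| ≤ ‖(a : ℂ) + (t : ℂ) * Complex.I‖ := by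
  simpa using Complex.abs_im_le_norm ((a : ℂ) + (t : ℂ) * Complex.I)

theorem abs_abscissa_le_norm_line (a t : ℝ) : |a| ≤ ‖(a : ℂ) + (t : ℂ) * Complex.I‖ := by
  simpa using Complex.abs_re_le_norm ((a : ℂ) + (t : ℂ) * Complex.I)

theorem line_ne_zero {a : ℝ} (ha : a ≠ 0) (t : ℝ) : (a : ℂ) + (t : ℂ) * Complex.I ≠ 0 :=
  fun h => ha (by simpa using congrArg Complex.re h)

theorem lineIntegrable_one_div_sq {a : ℝ} (ha : a ≠ 0) :
    LineIntegrable (fun l : ℂ => 1 / l ^ 2) a := by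
  refine integrable_of_norm_le_div_rpow (r := 2) (K := 1 / |a| ^ 2) (D := 1)
    (Continuous.div continuous_const ((continuous_line a).pow 2)
      fun t => pow_ne_zero 2 (line_ne_zero ha t)) one_lt_two (fun t => ?_) fun t ht => ?_
  · rw [norm_div, norm_one, norm_pow]
    gcongr
    exact abs_abscissa_le_norm_line a t
  · rw [norm_div, norm_one, norm_pow, Real.rpow_two]
    gcongr
    exact abs_le_norm_line a t

/-- With l = a + it, the function i/l is an antiderivative in t and vanishes at both ends. -/
theorem integral_line_one_div_sq {a : ℝ} (ha : a ≠ 0) :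
    ∫ t : ℝ, 1 / ((a : ℂ) + (t : ℂ) * Complex.I) ^ 2 = 0 := by
  have hderiv : ∀ t : ℝ, HasDerivAt
      (fun t : ℝ => Complex.I * ((a : ℂ) + (t : ℂ) * Complex.I)⁻¹)
      (1 / ((a : ℂ) + (t : ℂ) * Complex.I) ^ 2) t := by
    intro t
    have h1 : HasDerivAt (fun t : ℝ => (a : ℂ) + (t : ℂ) * Complex.I) Complex.I t := by
      simpa using ((Complex.ofRealCLM.hasDerivAt (x := t)).mul_const Complex.I).const_add (a : ℂ)
    refine ((h1.inv (line_ne_zero ha t)).const_mul Complex.I).congr_deriv ?_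
    rw [mul_div_assoc', mul_neg, Complex.I_mul_I, neg_neg]
  have hlim : ∀ L : Filter ℝ, Tendsto (fun t : ℝ => |t|) L atTop →
      Tendsto (fun t : ℝ => Complex.I * ((a : ℂ) + (t : ℂ) * Complex.I)⁻¹) L (𝓝 0) := by
    intro L hL
    have h : Tendsto (fun t : ℝ => ‖(a : ℂ) + (t : ℂ) * Complex.I‖) L atTop :=
      tendsto_atTop_mono (abs_le_norm_line a) hL
    have := (tendsto_inv₀_cobounded.comp (tendsto_norm_atTop_iff_cobounded.1 h)).const_mul
      Complex.I
    simpa using this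
  simpa using integral_of_hasDerivAt_of_tendsto hderiv (lineIntegrable_one_div_sq ha)
    (hlim _ tendsto_abs_atBot_atTop) (hlim _ tendsto_abs_atTop_atTop)

variable [NormedSpace ℂ E]

theorem lineIntegral_eq_smul (f : ℂ → E) (a : ℝ) :
    lineIntegral f a = Complex.I • ∫ t : ℝ, f ((a : ℂ) + (t : ℂ) * Complex.I) :=
  integral_smul _ _

/-- Cauchy's theorem: the line of integration may be shifted. -/
theorem lineIntegral_eq_of_differentiableOn [CompleteSpace E] {f : ℂ → E} {a b K : ℝ}
    (hd : DifferentiableOn ℂ f {l | l.re ∈ Set.uIcc a b})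
    (ha : LineIntegrable f a) (hb : LineIntegrable f b)
    (hK : ∀ l : ℂ, l.re ∈ Set.uIcc a b → l.im ≠ 0 → ‖f l‖ ≤ K / |l.im|) :
    lineIntegral f a = lineIntegral f b := by
  have hvert : ∀ c : ℝ, LineIntegrable f c →
      Tendsto (fun T : ℝ => Complex.I • ∫ y in (-T)..T, f ((c : ℂ) + (y : ℂ) * Complex.I)) atTop
        (𝓝 (lineIntegral f c)) := fun c hc => by
    rw [lineIntegral_eq_smul]
    exact (intervalIntegral_tendsto_integral hc tendsto_neg_atTop_atBot tendsto_id).const_smul _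
  -- The horizontal sides at height ±T contribute at most K|b - a|/T.
  have hhor : ∀ σ : ℝ, |σ| = 1 →
      Tendsto (fun T : ℝ => ∫ x in a..b, f ((x : ℂ) + ((σ * T : ℝ) : ℂ) * Complex.I)) atTop
        (𝓝 0) := by
    intro σ hσ
    have hlim : Tendsto (fun T : ℝ => K / T * |b - a|) atTop (𝓝 0) := by
      simpa using (tendsto_const_nhds.div_atTop tendsto_id).mul_const |b - a|
    refine squeeze_zero_norm' ?_ hlim
    filter_upwards [eventually_gt_atTop 0] with T hT
    refine intervalIntegral.norm_integral_le_of_norm_le_const fun x hx => ?_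
    have hσT : |σ * T| = T := by rw [abs_mul, hσ, one_mul, abs_of_pos hT]
    have := hK ((x : ℂ) + ((σ * T : ℝ) : ℂ) * Complex.I)
      (by simpa using Set.uIoc_subset_uIcc hx)
      (by
        have : σ * T ≠ 0 := abs_pos.1 (by rw [hσT]; exact hT)
        simpa using this)
    refine this.trans_eq ?_
    congr 1
    simpa using hσT
  have hrect : ∀ T : ℝ, (∫ x in a..b, f ((x : ℂ) + ((-1 * T : ℝ) : ℂ) * Complex.I)) -
      (∫ x in a..b, f ((x : ℂ) + ((1 * T : ℝ) : ℂ) * Complex.I)) +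
      Complex.I • (∫ y in (-T)..T, f ((b : ℂ) + (y : ℂ) * Complex.I)) -
      Complex.I • (∫ y in (-T)..T, f ((a : ℂ) + (y : ℂ) * Complex.I)) = 0 := by
    intro T
    have := Complex.integral_boundary_rect_eq_zero_of_differentiableOn f ⟨a, -T⟩ ⟨b, T⟩
      (hd.mono fun l hl => hl.1)
    simpa only [neg_one_mul, one_mul] using this
  have hlim := (((hhor (-1) (by simp)).sub (hhor 1 (by simp))).add (hvert b hb)).sub (hvert a ha)
  simp only [hrect, sub_zero, zero_add] at hlim
  exact (sub_eq_zero.1 (tendsto_nhds_unique hlim tendsto_const_nhds)).symm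

end Lines

/-! ### The operators A, B and P. -/

section Projections

theorem abs_abscissa (s : ℤˣ) {h : ℝ} (hh : 0 < h) : |abscissa s h| = h := by
  rcases Int.units_eq_one_or s with rfl | rfl <;> simp [abscissa, abs_of_pos hh]

theorem abscissa_ne_zero (s : ℤˣ) {h : ℝ} (hh : 0 < h) : abscissa s h ≠ 0 :=
  abs_pos.1 (by rwa [abs_abscissa s hh])

/-- The abscissas between `± h` and `± h'` are nonzero and of modulus at most `max h h'`. -/
theorem abs_le_of_mem_uIcc_abscissa {s : ℤˣ} {h h' r : ℝ} (hh : 0 < h) (hh' : 0 < h')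
    (hr : r ∈ Set.uIcc (abscissa s h) (abscissa s h')) : 0 < |r| ∧ |r| ≤ max h h' := by
  rw [Set.mem_uIcc] at hr
  rcases Int.units_eq_one_or s with rfl | rfl
  · simp only [abscissa, Units.val_one, Int.cast_one, one_mul] at hr
    have hr0 : 0 < r := by rcases hr with hr | hr <;> linarith [hr.1]
    rw [abs_of_pos hr0]
    exact ⟨hr0, le_max_iff.2 (hr.symm.imp And.right And.right)⟩
  · simp only [abscissa, Units.val_neg, Units.val_one, Int.cast_neg, Int.cast_one, neg_mul,
      one_mul] at hr
    have hr0 : r < 0 := by rcases hr with hr | hr <;> linarith [hr.2]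
    rw [abs_of_neg hr0]
    exact ⟨by linarith, le_max_iff.2 (hr.imp (fun h => by linarith [h.1])
      fun h => by linarith [h.1])⟩

variable {X : Type*} [NormedAddCommGroup X] [NormedSpace ℂ X] {S : X →ₗ.[ℂ] X}
  {s : ℤˣ} {h h' M β : ℝ}

theorem StripBounded.line_mem (hS : StripBounded S h) (s : ℤˣ) (t : ℝ) :
    (abscissa s h : ℂ) + (t : ℂ) * Complex.I ∈ resolventSet S :=
  hS.2.1 _ (by simp [abs_abscissa s hS.1])

theorem StripBounded.max (hS : StripBounded S h) (hS' : StripBounded S h') :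
    StripBounded S (max h h') := by
  rcases max_choice h h' with hm | hm <;> rw [hm] <;> assumption

variable [CompleteSpace X]

theorem StripBounded.continuous_line_resolvent (hS : StripBounded S h) (s : ℤˣ) :
    Continuous fun t : ℝ => resolvent S ((abscissa s h : ℂ) + (t : ℂ) * Complex.I) :=
  continuous_iff_continuousAt.2 fun t =>
    ContinuousAt.comp (g := resolvent S) (f := fun t : ℝ => (abscissa s h : ℂ) + t * Complex.I)
      (analyticAt_resolvent (hS.line_mem s t)).continuousAt (continuous_line _).continuousAt

theorem StripBounded.lineIntegrable_sq (hS : StripBounded S h) (s : ℤˣ) :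
    LineIntegrable (fun l => (1 / l ^ 2) • resolvent S l) (abscissa s h) := by
  obtain ⟨hh, -, C, hC⟩ := id hS
  have hC' : ∀ t : ℝ, ‖resolvent S ((abscissa s h : ℂ) + (t : ℂ) * Complex.I)‖ ≤ C := fun t =>
    hC _ (by simp [abs_abscissa s hh])
  have hC0 : 0 ≤ C := (norm_nonneg _).trans (hC' 0)
  refine Integrable.mono' ((lineIntegrable_one_div_sq (abscissa_ne_zero s hh)).norm.mul_const C)
    ?_ (Eventually.of_forall fun t => ?_)
  · exact ((continuous_const.div ((continuous_line _).pow 2)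
      fun t => pow_ne_zero 2 (line_ne_zero (abscissa_ne_zero s hh) t)).smul
        (hS.continuous_line_resolvent s)).aestronglyMeasurable
  · rw [norm_smul]
    exact mul_le_mul_of_nonneg_left (hC' t) (norm_nonneg _)

theorem StripBounded.lineIntegrable (hS : StripBounded S h)
    (hAB : IsAlmostBisectorialWith S M β) (s : ℤˣ) :
    LineIntegrable (fun l => (1 / l) • resolvent S l) (abscissa s h) := by
  obtain ⟨hh, hmem, C, hC⟩ := id hS
  obtain ⟨hβ0, hβ1, hM0, hM⟩ := hAB
  have hre (t : ℝ) : |((abscissa s h : ℂ) + (t : ℂ) * Complex.I).re| ≤ h := by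
    simp [abs_abscissa s hh]
  have hC0 : 0 ≤ C := (norm_nonneg _).trans (hC _ (hre 0))
  -- Comparison with the point `it` at distance h gives ‖R(l)‖ ≤ M(1 + hC)/|t|^β; the factor 1/l
  -- supplies the remaining power.
  refine integrable_of_norm_le_div_rpow (r := 1 + β) (K := 1 / h * C) (D := M * (1 + h * C))
    ?_ (by linarith) (fun t => ?_) fun t ht => ?_
  · exact (continuous_const.div (continuous_line _)
      (line_ne_zero (abscissa_ne_zero s hh))).smul (hS.continuous_line_resolvent s)
  · rw [norm_smul, norm_div, norm_one]
    gcongr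
    · exact (abs_abscissa s hh).symm.trans_le (abs_abscissa_le_norm_line _ t)
    · exact hC _ (hre t)
  · have ht0 : 0 < |t| := by linarith
    obtain ⟨h₁, h₂⟩ := hM ((t : ℂ) * Complex.I) (by simp) (by simpa using abs_pos.1 ht0)
    have hn : ‖(t : ℂ) * Complex.I‖ = |t| := by simp
    have h₃ := norm_resolvent_le_mul (hmem _ (hre t)) h₁
    rw [add_sub_cancel_right, Complex.norm_real, Real.norm_eq_abs, abs_abscissa s hh] at h₃
    rw [hn] at h₂
    rw [norm_smul, norm_div, norm_one, Real.rpow_add ht0, Real.rpow_one]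
    calc _ ≤ 1 / |t| * (M / |t| ^ β * (1 + h * C)) := by
          gcongr
          · exact abs_le_norm_line _ t
          · refine h₃.trans ?_
            gcongr
            exact hC _ (hre t)
      _ = _ := by field_simp

/-- The abscissas between ±h and ±h' avoid 0, so the pole of 1/l is not crossed, and the larger of
the two strips supplies boundedness. -/
theorem opB_eq_opB (hAB : IsAlmostBisectorialWith S M β) (hS : StripBounded S h)
    (hS' : StripBounded S h') (s : ℤˣ) : opB S s h = opB S s h' := by
  obtain ⟨-, hmem, C, hC⟩ := hS.max hS'
  have hstrip {l : ℂ} (hl : l.re ∈ Set.uIcc (abscissa s h) (abscissa s h')) :=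
    abs_le_of_mem_uIcc_abscissa hS.1 hS'.1 hl
  rw [opB, opB, lineIntegral_eq_of_differentiableOn (K := C) (fun l hl => ?_)
    (hS.lineIntegrable hAB s) (hS'.lineIntegrable hAB s) fun l hl him => ?_]
  · obtain ⟨h₁, h₂⟩ := hstrip hl
    have hl0 : l ≠ 0 := fun h0 => by simp [h0] at h₁
    exact (DifferentiableAt.smul (f := resolvent S)
      ((differentiableAt_const (1 : ℂ)).fun_div differentiableAt_id hl0)
      (analyticAt_resolvent (hmem l h₂)).differentiableAt).differentiableWithinAt
  · have him' : 0 < |l.im| := abs_pos.2 him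
    have hC' := hC l (hstrip hl).2
    have hC0 : 0 ≤ C := (norm_nonneg _).trans hC'
    rw [norm_smul, norm_div, norm_one, div_mul_eq_mul_div, one_mul]
    gcongr
    exact Complex.abs_im_le_norm l

/-- Integrates R(0)R(l)/l = (R(l) - R(0))/l²; the R(0) term drops out because 1/l² has integral
zero. -/
theorem resolvent_zero_mul_opB (hAB : IsAlmostBisectorialWith S M β) (hS : StripBounded S h)
    (s : ℤˣ) : resolvent S 0 * opB S s h = opA S s h := by
  have h0 := hAB.zero_mem_resolventSet
  have hne := abscissa_ne_zero s hS.1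
  have hpt : ∀ t : ℝ, resolvent S 0 * ((1 / ((abscissa s h : ℂ) + (t : ℂ) * Complex.I)) •
      resolvent S ((abscissa s h : ℂ) + (t : ℂ) * Complex.I)) =
      (1 / ((abscissa s h : ℂ) + (t : ℂ) * Complex.I) ^ 2) •
        resolvent S ((abscissa s h : ℂ) + (t : ℂ) * Complex.I) -
      (1 / ((abscissa s h : ℂ) + (t : ℂ) * Complex.I) ^ 2) • resolvent S 0 := by
    intro t
    have hl := hS.line_mem s t
    have hl0 := line_ne_zero hne t
    set l := (abscissa s h : ℂ) + (t : ℂ) * Complex.I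
    ext y
    have := resolvent_eq_add hl h0 y
    rw [resolvent_comm hl h0, sub_zero] at this
    change resolvent S 0 ((1 / l) • resolvent S l y) =
      (1 / l ^ 2) • resolvent S l y - (1 / l ^ 2) • resolvent S 0 y
    rw [map_smul, ← smul_sub, sub_eq_of_eq_add' this, smul_smul]
    congr 1
    field_simp
  rw [opA, opB, mul_smul_comm, lineIntegral_eq_smul, lineIntegral_eq_smul, mul_smul_comm,
    ← integral_const_mul_of_integrable (hS.lineIntegrable hAB s)]
  simp only [hpt]
  rw [integral_sub (hS.lineIntegrable_sq s)
    ((lineIntegrable_one_div_sq hne).smul_const (resolvent S 0)), integral_smul_const,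
    integral_line_one_div_sq hne, zero_smul, sub_zero]

theorem opB_mul_resolvent_zero (hAB : IsAlmostBisectorialWith S M β) (hS : StripBounded S h)
    (s : ℤˣ) : opB S s h * resolvent S 0 = resolvent S 0 * opB S s h := by
  have h0 := hAB.zero_mem_resolventSet
  rw [opB, mul_smul_comm, smul_mul_assoc, lineIntegral_eq_smul, mul_smul_comm, smul_mul_assoc,
    ← integral_const_mul_of_integrable (hS.lineIntegrable hAB s),
    ← integral_mul_const_of_integrable (hS.lineIntegrable hAB s)]
  congr 3
  ext t y
  simp [resolvent_comm h0 (hS.line_mem s t)]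

theorem opA_apply (hAB : IsAlmostBisectorialWith S M β) (hS : StripBounded S h)
    (hS' : StripBounded S h') (x : X) : opA S s h x = resolvent S 0 (opB S s h' x) := by
  rw [← resolvent_zero_mul_opB hAB hS, opB_eq_opB hAB hS hS']
  rfl

theorem apply_opA (hAB : IsAlmostBisectorialWith S M β) (hS : StripBounded S h)
    (hS' : StripBounded S h') (x : X) (hx : opA S s h x ∈ S.domain) :
    S ⟨opA S s h x, hx⟩ = opB S s h' x := by
  have := apply_resolvent hAB.zero_mem_resolventSet (opB S s h' x)
  rw [zero_smul, add_zero] at this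
  rw [← this]
  congr 1
  exact Subtype.ext (opA_apply hAB hS hS' x)

/-- As A = S⁻¹B, the range of A lies in the domain of S and SA = B everywhere, so the two domain
conditions coincide. -/
theorem opP_eq (hAB : IsAlmostBisectorialWith S M β) (hS : StripBounded S h)
    (hS' : StripBounded S h') (s : ℤˣ) :
    opP S s h = prodOp S (ofBounded (opB S s h')) := by
  refine LinearPMap.ext ?_ ?_
  · ext x
    constructor
    · rintro ⟨_, hA, hx⟩
      refine ⟨trivial, ?_⟩
      have hA' : opA S s h x ∈ S.domain := hA
      have hx' : S ⟨opA S s h x, hA'⟩ ∈ S.domain := hx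
      rwa [apply_opA hAB hS hS'] at hx'
    · rintro ⟨_, hx⟩
      have hA : opA S s h x ∈ S.domain := by
        rw [opA_apply hAB hS hS']
        exact resolvent_mem_domain hAB.zero_mem_resolventSet _
      refine ⟨trivial, hA, ?_⟩
      change S ⟨opA S s h x, hA⟩ ∈ S.domain
      rwa [apply_opA hAB hS hS']
  · rintro x ⟨_, hA, hx⟩ hg
    refine congrArg S (Subtype.ext ?_)
    exact apply_opA hAB hS hS' x hA

theorem opB_apply (hAB : IsAlmostBisectorialWith S M β) (hS : StripBounded S h) (x : X) :
    opB S s h x =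
      cauchyFactor s • lineIntegral (fun l => (1 / l) • resolvent S l x) (abscissa s h) := by
  rw [opB, smul_apply, lineIntegral_eq_smul, lineIntegral_eq_smul, smul_apply,
    ContinuousLinearMap.integral_apply (hS.lineIntegrable hAB s)]
  rfl

/-- Writes x = S⁻¹Sx and commutes B past S⁻¹; hence Bx is in the domain of S and SBx = BSx. -/
theorem opB_apply_domain (hAB : IsAlmostBisectorialWith S M β) (hS : StripBounded S h)
    (x : S.domain) : opB S s h x = resolvent S 0 (opB S s h (S x)) := by
  have h0 := hAB.zero_mem_resolventSet
  have hx := resolvent_apply h0 x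
  rw [zero_smul, add_zero] at hx
  have : opB S s h (resolvent S 0 (S x)) = resolvent S 0 (opB S s h (S x)) :=
    DFunLike.congr_fun (opB_mul_resolvent_zero hAB hS s) (S x)
  rwa [hx] at this

theorem domain_le_prodOp_opB (hAB : IsAlmostBisectorialWith S M β) (hS : StripBounded S h)
    (s : ℤˣ) : S.domain ≤ (prodOp S (ofBounded (opB S s h))).domain := fun x hx => by
  refine ⟨trivial, ?_⟩
  change opB S s h x ∈ S.domain
  rw [opB_apply_domain hAB hS ⟨x, hx⟩]
  exact resolvent_mem_domain hAB.zero_mem_resolventSet _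

theorem prodOp_opB_apply (hAB : IsAlmostBisectorialWith S M β) (hS : StripBounded S h)
    (x : S.domain) (hx : (x : X) ∈ (prodOp S (ofBounded (opB S s h))).domain) :
    prodOp S (ofBounded (opB S s h)) ⟨x, hx⟩ =
      cauchyFactor s • lineIntegral (fun l => (1 / l) • resolvent S l (S x)) (abscissa s h) := by
  rw [← opB_apply hAB hS]
  have := apply_resolvent hAB.zero_mem_resolventSet (opB S s h (S x))
  rw [zero_smul, add_zero] at this
  rw [← this]
  refine congrArg S (Subtype.ext ?_)
  exact opB_apply_domain hAB hS x

theorem StripBounded.lineIntegrable_apply (hS : StripBounded S h)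
    (hAB : IsAlmostBisectorialWith S M β) (s : ℤˣ) (y : X) :
    LineIntegrable (fun l => (1 / l) • resolvent S l y) (abscissa s h) :=
  (ContinuousLinearMap.apply ℂ X y).integrable_comp (hS.lineIntegrable hAB s)

end Projections

end SpectralSplitting

end

theorem theorem5p6 {X : Type*} [NormedAddCommGroup X] [NormedSpace ℂ X] [CompleteSpace X]
    (S : X →ₗ.[ℂ] X) :
    (∀ M β : ℝ, SpectralSplitting.IsAlmostBisectorialWith S M β →
      (∃ h : ℝ, SpectralSplitting.StripBounded S h) ∧
      (∀ h h' : ℝ, SpectralSplitting.StripBounded S h → SpectralSplitting.StripBounded S h' →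
        ∀ s : ℤˣ,
          SpectralSplitting.LineIntegrable
            (fun l => (1 / l ^ 2) • SpectralSplitting.resolvent S l)
            (SpectralSplitting.abscissa s h) ∧
          SpectralSplitting.LineIntegrable
            (fun l => (1 / l) • SpectralSplitting.resolvent S l)
            (SpectralSplitting.abscissa s h') ∧
          SpectralSplitting.opP S s h =
            SpectralSplitting.prodOp S
              (SpectralSplitting.ofBounded (SpectralSplitting.opB S s h')) ∧
          S.domain ≤ (SpectralSplitting.opP S s h).domain ∧
          ∀ (x : S.domain) (hx : (x : X) ∈ (SpectralSplitting.opP S s h).domain),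
            SpectralSplitting.LineIntegrable
              (fun l => (1 / l) • SpectralSplitting.resolvent S l (S x))
              (SpectralSplitting.abscissa s h') ∧
            SpectralSplitting.opP S s h ⟨x, hx⟩ =
              SpectralSplitting.cauchyFactor s •
                SpectralSplitting.lineIntegral
                  (fun l => (1 / l) • SpectralSplitting.resolvent S l (S x))
                  (SpectralSplitting.abscissa s h')) ∧
      (∀ s : ℤˣ,
        IsClosed (SpectralSplitting.splitSpace S s : Set X) ∧
        ∃ hG : SpectralSplitting.IsInvariant S (SpectralSplitting.splitSpace S s),
          SpectralSplitting.IsAlmostSectorialWith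
            (s • SpectralSplitting.restrictOp S (SpectralSplitting.splitSpace S s) hG)
            (Real.pi / 2) M β)) ∧
    (SpectralSplitting.IsBisectorial S → (0 : ℂ) ∈ SpectralSplitting.resolventSet S →
      (∃ θ M : ℝ, SpectralSplitting.IsBisectorialOn S θ M) ∧
      ∀ θ M : ℝ, SpectralSplitting.IsBisectorialOn S θ M →
        ∀ s : ℤˣ,
          IsClosed (SpectralSplitting.splitSpace S s : Set X) ∧
          ∃ hG : SpectralSplitting.IsInvariant S (SpectralSplitting.splitSpace S s),
            SpectralSplitting.IsSectorialWith
              (s • SpectralSplitting.restrictOp S (SpectralSplitting.splitSpace S s) hG)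
              θ M) := by
  refine ⟨fun M β hAB => ?_, fun hB h0 => ⟨hB.exists_isBisectorialOn, fun θ M hθ s => ?_⟩⟩
  · obtain ⟨C, hC0, hC⟩ := hAB.exists_bound
    refine ⟨SpectralSplitting.exists_stripBounded hC0 hC, fun h h' hS hS' s => ?_, fun s => ?_⟩
    · refine ⟨hS.lineIntegrable_sq s, hS'.lineIntegrable hAB s,
        SpectralSplitting.opP_eq hAB hS hS' s, ?_⟩
      rw [SpectralSplitting.opP_eq hAB hS hS' s]
      exact ⟨SpectralSplitting.domain_le_prodOp_opB hAB hS' s, fun x hx =>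
        ⟨hS'.lineIntegrable_apply hAB s _, SpectralSplitting.prodOp_opB_apply hAB hS' x hx⟩⟩
    · exact ⟨SpectralSplitting.isClosed_splitSpace hC s,
        SpectralSplitting.isInvariant_splitSpace hC s, hAB.isAlmostSectorialWith hC _⟩
  · obtain ⟨C, -, hC⟩ := hB.exists_bound h0
    exact ⟨SpectralSplitting.isClosed_splitSpace hC s,
      SpectralSplitting.isInvariant_splitSpace hC s, hθ.isSectorialWith hC _⟩
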